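/- Let $R$ be an associative ring with unit and let $n>1$ be an integer. A module $M$ is \emph{finitely $n$-presented} if there is an exact sequence $F_n\to F_{n-1}\to\cdots\to F_0\to M\to 0$ with all $F_i$ finitely generated and free. The ring $R$ is (left) \emph{$n$-hereditary} if every finitely $(n-1)$-presented submodule of a finitely generated projective left $R$-module is projective. A left $R$-module $M$ is \emph{$FP_n$-injective} if $\mathrm{Ext}^1_R(F,M)=0$ for every finitely $n$-presented left $R$-module $F$; a right $R$-module $M$ is \emph{$FP_n$-flat} if $\mathrm{Tor}_1^R(M,F)=0$ for every finitely $n$-presented left $R$-module $F$. A module $T$ is \emph{$1$-tilting} if it has projective dimension at most $1$, $\mathrm{Ext}^i(T,T^{(I)})=0$ for all $i\ge 1$ and all sets $I$, and there is an exact sequence $0\to R\to T_0\to T_1\to 0$ with $T_0,T_1$ isomorphic to direct summands of direct sums of copies of $T$ (here $R$ is the regular module on the same side as $T$). A module $C$ is \emph{$1$-cotilting} if it has injective dimension at most $1$, $\mathrm{Ext}^i(C^{I},C)=0$ for all $i\ge 1$ and all sets $I$, and there are an injective cogenerator $Q$ and an exact sequence $0\to C_1\to C_0\to Q\to 0$ with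 $C_0,C_1$ isomorphic to direct summands of direct products of copies of $C$. A class of modules is a \emph{$1$-tilting class} if it equals $\{M:\mathrm{Ext}^1(T,M)=0\}$ for some $1$-tilting module $T$, and a \emph{$1$-cotilting class} if it equals $\{M:\mathrm{Ext}^1(M,C)=0\}$ for some $1$-cotilting module $C$. \textbf{Theorem.} The following statements are equivalent: \begin{enumerate} \item $R$ is an $n$-hereditary ring; \item the class of $FP_n$-injective left $R$-modules is a $1$-tilting class (of left $R$-modules); \item the class of $FP_n$-flat right $R$-modules is a $1$-cotilting class (of right $R$-modules). \end{enumerate} -/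

import Mathlib

open CategoryTheory MulOpposite
open scoped TensorProduct

universe u

namespace FPn

noncomputable section

/-! Throughout, left `R`-modules are objects of `ModuleCat.{u} R`, and right `R`-modules are left
modules over the opposite ring, i.e. objects of `ModuleCat.{u} Rᵐᵒᵖ`. -/

/-- `M` is finitely `n`-presented: there is an exact sequence
`F_n → F_{n-1} → ⋯ → F_1 → F_0 → M → 0` in which every `F_i = R ^ (k i)` is finitely generated
and free. Only `k i` for `i ≤ n` and `d i` for `i < n` are constrained. -/
def IsFinitelyNPresented (R : Type*) [Ring R] (n : ℕ)
    (M : Type*) [AddCommGroup M] [Module R M] : Prop :=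
  ∃ (k : ℕ → ℕ) (d : ∀ i : ℕ, (Fin (k (i + 1)) → R) →ₗ[R] (Fin (k i) → R))
    (ε : (Fin (k 0) → R) →ₗ[R] M),
    Function.Surjective ε ∧
    (0 < n → Function.Exact (d 0) ε) ∧
    ∀ i : ℕ, i + 1 < n → Function.Exact (d (i + 1)) (d i)

/-- `R` is left `n`-hereditary: every finitely `(n-1)`-presented submodule of a finitely generated
projective left `R`-module is projective. (For `n = 0`, "finitely `(-1)`-presented" is no
condition.) -/
def IsNHereditary (R : Type u) [Ring R] (n : ℕ) : Prop :=
  ∀ (P : Type u) [AddCommGroup P] [Module R P] [Module.Finite R P] [Module.Projective R P]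
    (N : Submodule R P), (n ≠ 0 → IsFinitelyNPresented R (n - 1) N) → Module.Projective R N

/-! ### The tensor product of a right and a left module, and its derived functors -/

section Tensor

variable {R : Type u} [Ring R]

/-- The subgroup of `M ⊗[ℤ] N` generated by the elements `(m r) ⊗ x - m ⊗ (r x)`. -/
def balancedSubgroup (M : ModuleCat.{u} Rᵐᵒᵖ) (N : ModuleCat.{u} R) : AddSubgroup (M ⊗[ℤ] N) :=
  AddSubgroup.closure
    {t | ∃ (m : M) (r : R) (x : N), t = (op r • m) ⊗ₜ[ℤ] x - m ⊗ₜ[ℤ] (r • x)}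

/-- The abelian group `M ⊗_R N`, for a right `R`-module `M` and a left `R`-module `N`. -/
abbrev TensorOver (M : ModuleCat.{u} Rᵐᵒᵖ) (N : ModuleCat.{u} R) : Type u :=
  (M ⊗[ℤ] N) ⧸ balancedSubgroup M N

/-- The homomorphism `M ⊗[ℤ] N → M ⊗[ℤ] N'` induced by `f : N ⟶ N'`. -/
def intTensorMap (M : ModuleCat.{u} Rᵐᵒᵖ) {N N' : ModuleCat.{u} R} (f : N ⟶ N') :
    M ⊗[ℤ] N →+ M ⊗[ℤ] N' :=
  (LinearMap.lTensor M (f.hom.toAddMonoidHom.toIntLinearMap)).toAddMonoidHom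

@[simp]
theorem intTensorMap_tmul (M : ModuleCat.{u} Rᵐᵒᵖ) {N N' : ModuleCat.{u} R} (f : N ⟶ N')
    (m : M) (x : N) : intTensorMap M f (m ⊗ₜ[ℤ] x) = m ⊗ₜ[ℤ] (f.hom x) := rfl

theorem balancedSubgroup_le_comap (M : ModuleCat.{u} Rᵐᵒᵖ) {N N' : ModuleCat.{u} R}
    (f : N ⟶ N') :
    balancedSubgroup M N ≤ (balancedSubgroup M N').comap (intTensorMap M f) := by
  refine (AddSubgroup.closure_le _).2 ?_
  rintro _ ⟨m, r, x, rfl⟩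
  refine AddSubgroup.subset_closure ⟨m, r, f.hom x, ?_⟩
  simp [map_sub]

/-- The homomorphism `M ⊗_R N → M ⊗_R N'` induced by `f : N ⟶ N'`. -/
def tensorMap (M : ModuleCat.{u} Rᵐᵒᵖ) {N N' : ModuleCat.{u} R} (f : N ⟶ N') :
    TensorOver M N →+ TensorOver M N' :=
  QuotientAddGroup.map _ _ (intTensorMap M f) (balancedSubgroup_le_comap M f)

@[simp]
theorem tensorMap_mk_tmul (M : ModuleCat.{u} Rᵐᵒᵖ) {N N' : ModuleCat.{u} R} (f : N ⟶ N')
    (m : M) (x : N) :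
    tensorMap M f (QuotientAddGroup.mk (m ⊗ₜ[ℤ] x)) =
      QuotientAddGroup.mk (m ⊗ₜ[ℤ] (f.hom x)) := rfl

/-- Two homomorphisms out of `M ⊗_R N` which agree on elementary tensors are equal. -/
theorem tensorOver_hom_ext {M : ModuleCat.{u} Rᵐᵒᵖ} {N : ModuleCat.{u} R} {A : Type*}
    [AddCommGroup A] {f g : TensorOver M N →+ A}
    (h : ∀ (m : M) (x : N), f (QuotientAddGroup.mk (m ⊗ₜ[ℤ] x)) =
      g (QuotientAddGroup.mk (m ⊗ₜ[ℤ] x))) : f = g := by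
  ext t
  induction t using TensorProduct.induction_on with
  | zero => simp
  | tmul m x => exact h m x
  | add a b ha hb =>
    have ha' := ha
    have hb' := hb
    simp only [AddMonoidHom.coe_comp, Function.comp_apply] at ha' hb' ⊢
    rw [map_add, map_add, map_add, ha', hb']

/-- The functor `M ⊗_R -` from left `R`-modules to abelian groups. -/
def tensorFunctor (M : ModuleCat.{u} Rᵐᵒᵖ) : ModuleCat.{u} R ⥤ AddCommGrpCat.{u} where
  obj N := AddCommGrpCat.of (TensorOver M N)
  map f := AddCommGrpCat.ofHom (tensorMap M f)
  map_id N := by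
    refine AddCommGrpCat.hom_ext (tensorOver_hom_ext fun m x => ?_)
    rfl
  map_comp f g := by
    refine AddCommGrpCat.hom_ext (tensorOver_hom_ext fun m x => ?_)
    rfl

instance (M : ModuleCat.{u} Rᵐᵒᵖ) : (tensorFunctor M).Additive where
  map_add {N N'} {f g} := by
    refine AddCommGrpCat.hom_ext (tensorOver_hom_ext fun m x => ?_)
    change QuotientAddGroup.mk (m ⊗ₜ[ℤ] (f.hom x + g.hom x)) = _
    rw [TensorProduct.tmul_add]
    rfl

/-- `Tor_i^R(M, N)`, for a right `R`-module `M` and a left `R`-module `N`: the `i`-th left derived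
functor of `M ⊗_R -`, evaluated at `N`. -/
def Tor (i : ℕ) (M : ModuleCat.{u} Rᵐᵒᵖ) (N : ModuleCat.{u} R) : AddCommGrpCat.{u} :=
  ((tensorFunctor M).leftDerived i).obj N

end Tensor

/-! ### `FP_n`-injective and `FP_n`-flat modules -/

/-- The class of `FP_n`-injective left `R`-modules: `Ext¹_R(F, M) = 0` for all finitely
`n`-presented left modules `F`. -/
def FPInj (R : Type u) [Ring R] (n : ℕ) : ObjectProperty (ModuleCat.{u} R) :=
  fun M => ∀ F : ModuleCat.{u} R, IsFinitelyNPresented R n F → Subsingleton (Abelian.Ext F M 1)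

/-- The class of `FP_n`-flat right `R`-modules: `Tor₁^R(M, F) = 0` for all finitely `n`-presented
left modules `F`. -/
def FPFlat (R : Type u) [Ring R] (n : ℕ) : ObjectProperty (ModuleCat.{u} Rᵐᵒᵖ) :=
  fun M => ∀ F : ModuleCat.{u} R, IsFinitelyNPresented R n F → Subsingleton (Tor 1 M F)

/-! ### Tilting and cotilting modules and classes -/

section Tilting

variable {S : Type u} [Ring S]

/-- `X` is isomorphic to a direct summand of a direct sum of copies of `T`. -/
def IsSummandOfSum (T X : ModuleCat.{u} S) : Prop :=
  ∃ (I : Type u) (Y : ModuleCat.{u} S), Nonempty ((I →₀ T) ≃ₗ[S] (X × Y))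

/-- `X` is isomorphic to a direct summand of a direct product of copies of `C`. -/
def IsSummandOfProd (C X : ModuleCat.{u} S) : Prop :=
  ∃ (I : Type u) (Y : ModuleCat.{u} S), Nonempty ((I → C) ≃ₗ[S] (X × Y))

/-- `T` is a `1`-tilting `S`-module. -/
structure IsOneTilting (T : ModuleCat.{u} S) : Prop where
  projectiveDimension_le_one : HasProjectiveDimensionLE T 1
  ext_directSum_eq_zero : ∀ (I : Type u) (i : ℕ), 1 ≤ i →
    Subsingleton (Abelian.Ext T (ModuleCat.of S (I →₀ T)) i)
  exists_coresolution : ∃ (T₀ T₁ : ModuleCat.{u} S) (f : S →ₗ[S] T₀) (g : T₀ →ₗ[S] T₁),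
    IsSummandOfSum T T₀ ∧ IsSummandOfSum T T₁ ∧
    Function.Injective f ∧ Function.Exact f g ∧ Function.Surjective g

/-- `C` is a `1`-cotilting `S`-module. -/
structure IsOneCotilting (C : ModuleCat.{u} S) : Prop where
  injectiveDimension_le_one : HasInjectiveDimensionLE C 1
  ext_prod_eq_zero : ∀ (I : Type u) (i : ℕ), 1 ≤ i →
    Subsingleton (Abelian.Ext (ModuleCat.of S (I → C)) C i)
  exists_resolution : ∃ Q : ModuleCat.{u} S, Injective Q ∧ IsCoseparator Q ∧
    ∃ (C₁ C₀ : ModuleCat.{u} S) (f : C₁ →ₗ[S] C₀) (g : C₀ →ₗ[S] Q),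
      IsSummandOfProd C C₀ ∧ IsSummandOfProd C C₁ ∧
      Function.Injective f ∧ Function.Exact f g ∧ Function.Surjective g

/-- `𝒞` is a `1`-tilting class: `𝒞 = Ker Ext¹(T, -)` for some `1`-tilting module `T`. -/
def IsOneTiltingClass (𝒞 : ObjectProperty (ModuleCat.{u} S)) : Prop :=
  ∃ T : ModuleCat.{u} S, IsOneTilting T ∧
    ∀ M : ModuleCat.{u} S, 𝒞 M ↔ Subsingleton (Abelian.Ext T M 1)

/-- `𝒞` is a `1`-cotilting class: `𝒞 = Ker Ext¹(-, C)` for some `1`-cotilting module `C`. -/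
def IsOneCotiltingClass (𝒞 : ObjectProperty (ModuleCat.{u} S)) : Prop :=
  ∃ C : ModuleCat.{u} S, IsOneCotilting C ∧
    ∀ M : ModuleCat.{u} S, 𝒞 M ↔ Subsingleton (Abelian.Ext M C 1)

end Tilting

end

end FPn

/-! A finitely n-presented F is R^k modulo a finitely (n-1)-presented K, so R is n-hereditary
exactly when every such F has projective dimension at most 1 (`isNHereditary_iff`). By dimension
shifting along injectives, this says that the FP_n-injective modules are closed under quotients. A
1-tilting class is closed under quotients because pd T ≤ 1, so 2 implies 1. Conversely, the small
object argument (`exists_special_preenvelope`) embeds R in an FP_n-injective T₀ whose cokernel T₁ is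
left orthogonal to all FP_n-injectives. Then T = T₀ ⊕ T₁ is tilting, and any M with Ext¹(T, M) = 0
is a quotient of a direct sum of copies of T₀, hence FP_n-injective.

Right modules are reached through character modules X⁺ = Hom_ℤ(X, ℚ/ℤ). Tor₁(M, F) vanishes iff
Ext¹(F, M⁺) does, so M is FP_n-flat iff M⁺ is FP_n-injective; and Ext¹(T, M⁺) vanishes iff Ext¹(M,
T⁺) does (`balanced_extension`). Hence C = T⁺ cuts out the FP_n-flat class. The powers of C are
duals of FP_n-injectives, and over an n-hereditary ring such duals are FP_n-flat
(`double_dual_extension`).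

For 3 implies 1, id C ≤ 1 makes the FP_n-flat class closed under submodules, so it contains every
submodule of a free module. Shifting dimensions on both sides gives Ext¹(K, M⁺) = 0 for every right
module M and the syzygy K of F. As n > 1, K is finitely presented, and taking M to be the dual of
its relation module forces K to be projective (`projective_of_double_dual_extension`). -/

namespace FPn

noncomputable section

/-! ### Character modules over a ring and its opposite -/

section CharDual

/-- A ring homomorphism from `S` to the opposite of `R`, making the character group of an
`R`-module an `S`-module. -/
class AntiHom (S R : Type*) [Ring S] [Ring R] where
  /-- The underlying homomorphism to the opposite ring. -/
  hom : S →+* Rᵐᵒᵖ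

/-- The underlying anti-multiplicative map of `AntiHom`. -/
def anti {S : Type*} (R : Type*) [Ring S] [Ring R] [AntiHom S R] (s : S) : R :=
  unop (AntiHom.hom (R := R) s)

/-- The two given anti-homomorphisms between `R` and `S` are mutually inverse. -/
class AntiPair (R S : Type*) [Ring R] [Ring S] [AntiHom S R] [AntiHom R S] : Prop where
  anti_anti_left : ∀ r : R, anti R (anti S r) = r
  anti_anti_right : ∀ s : S, anti S (anti R s) = s

/-- With an instance in each direction, one duality lemma serves both left and right modules, and
the dual of a right module is an R-module rather than an `Rᵐᵒᵖᵐᵒᵖ`-module. -/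
instance (R : Type*) [Ring R] : AntiHom Rᵐᵒᵖ R := ⟨RingHom.id _⟩

instance (R : Type*) [Ring R] : AntiHom R Rᵐᵒᵖ := ⟨(RingEquiv.opOp R).toRingHom⟩

instance (R : Type*) [Ring R] : AntiPair R Rᵐᵒᵖ := ⟨fun _ => rfl, fun _ => rfl⟩

instance (R : Type*) [Ring R] : AntiPair Rᵐᵒᵖ R := ⟨fun _ => rfl, fun _ => rfl⟩

section anti
variable {R S : Type*} [Ring R] [Ring S] [AntiHom S R]

theorem anti_one : anti R (1 : S) = 1 := by simp [anti]
theorem anti_zero : anti R (0 : S) = 0 := by simp [anti]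
theorem anti_add (a b : S) : anti R (a + b) = anti R a + anti R b := by simp [anti]
theorem anti_mul (a b : S) : anti R (a * b) = anti R b * anti R a := by simp [anti]

end anti

/-- The group of characters of an `R`-module `X` with values in `ℚ/ℤ`, as an `S`-module. -/
def CharDual (_R _S X : Type*) [AddCommGroup X] : Type _ := X →+ AddCircle (1 : ℚ)

namespace CharDual

variable {R S X Y Z : Type*} [AddCommGroup X] [AddCommGroup Y] [AddCommGroup Z]

instance : AddCommGroup (CharDual R S X) := inferInstanceAs (AddCommGroup (X →+ _))

instance : FunLike (CharDual R S X) X (AddCircle (1 : ℚ)) :=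
  inferInstanceAs (FunLike (X →+ _) X _)

instance : AddMonoidHomClass (CharDual R S X) X (AddCircle (1 : ℚ)) :=
  inferInstanceAs (AddMonoidHomClass (X →+ _) X _)

@[ext] theorem ext {φ ψ : CharDual R S X} (h : ∀ x, φ x = ψ x) : φ = ψ := DFunLike.ext _ _ h

@[simp] theorem add_apply (φ ψ : CharDual R S X) (x : X) : (φ + ψ) x = φ x + ψ x := rfl
@[simp] theorem sub_apply (φ ψ : CharDual R S X) (x : X) : (φ - ψ) x = φ x - ψ x := rfl
@[simp] theorem zero_apply (x : X) : (0 : CharDual R S X) x = 0 := rfl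

@[simp] theorem sum_apply {ι : Type*} (s : Finset ι) (φ : ι → CharDual R S X) (x : X) :
    (∑ i ∈ s, φ i) x = ∑ i ∈ s, φ i x :=
  AddMonoidHom.finsetSum_apply (M := X) φ s x

variable [Ring R] [Ring S] [Module R X] [Module R Y] [Module R Z] [AntiHom S R]

instance : Module S (CharDual R S X) where
  smul s φ := AddMonoidHom.comp (φ : X →+ _) (DistribSMul.toAddMonoidHom X (anti R s))
  one_smul φ := by
    refine ext fun x => ?_
    change φ (anti R (1 : S) • x) = φ x
    rw [anti_one, one_smul]
  mul_smul a b φ := by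
    refine ext fun x => ?_
    change φ (anti R (a * b) • x) = φ (anti R b • anti R a • x)
    rw [anti_mul, mul_smul]
  smul_zero a := rfl
  smul_add a φ ψ := rfl
  add_smul a b φ := by
    refine ext fun x => ?_
    change φ (anti R (a + b) • x) = φ (anti R a • x) + φ (anti R b • x)
    rw [anti_add, add_smul, map_add]
  zero_smul φ := by
    refine ext fun x => ?_
    change φ (anti R (0 : S) • x) = 0
    rw [anti_zero, zero_smul, map_zero]

@[simp] theorem smul_apply (s : S) (φ : CharDual R S X) (x : X) :
    (s • φ) x = φ (anti R s • x) := rfl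

variable (S) in
/-- The map of character modules induced by a linear map. -/
def map (f : X →ₗ[R] Y) : CharDual R S Y →ₗ[S] CharDual R S X where
  toFun φ := AddMonoidHom.comp (φ : Y →+ _) f.toAddMonoidHom
  map_add' _ _ := rfl
  map_smul' s φ := by
    refine ext fun x => ?_
    change φ (anti R s • f x) = φ (f (anti R s • x))
    rw [f.map_smul]

@[simp] theorem map_apply (f : X →ₗ[R] Y) (φ : CharDual R S Y) (x : X) :
    map S f φ x = φ (f x) := rfl

theorem map_injective {f : X →ₗ[R] Y} (hf : Function.Surjective f) :
    Function.Injective (map S f) := by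
  intro φ ψ h
  refine ext fun y => ?_
  obtain ⟨x, rfl⟩ := hf y
  exact DFunLike.congr_fun h x

end CharDual

/-- A character of a subgroup extends along any injective homomorphism. -/
theorem exists_character_extension {A B : Type*} [AddCommGroup A] [AddCommGroup B] (i : A →+ B)
    (hi : Function.Injective i) (χ : A →+ AddCircle (1 : ℚ)) :
    ∃ ψ : B →+ AddCircle (1 : ℚ), ψ.comp i = χ := by
  obtain ⟨ψ, hψ⟩ := CharacterModule.dual_surjective_of_injective i.toIntLinearMap hi χ
  exact ⟨ψ, AddMonoidHom.ext fun a => DFunLike.congr_fun hψ a⟩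

/-- A character of `B` killing the kernel of `b : B → C` extends to `C`. -/
theorem exists_character_factor {B C : Type*} [AddCommGroup B] [AddCommGroup C] (b : B →+ C)
    (χ : B →+ AddCircle (1 : ℚ)) (h : ∀ x, b x = 0 → χ x = 0) :
    ∃ ψ : C →+ AddCircle (1 : ℚ), ψ.comp b = χ := by
  obtain ⟨ψ, hψ⟩ := exists_character_extension (QuotientAddGroup.kerLift b)
    (QuotientAddGroup.kerLift_injective b) (QuotientAddGroup.lift b.ker χ h)
  exact ⟨ψ, AddMonoidHom.ext fun x => DFunLike.congr_fun hψ (QuotientAddGroup.mk x)⟩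

/-- An element outside a subgroup is separated from it by a character. -/
theorem exists_character_separating {A : Type*} [AddCommGroup A] (H : AddSubgroup A) {a : A}
    (ha : a ∉ H) : ∃ χ : A →+ AddCircle (1 : ℚ), (∀ x ∈ H, χ x = 0) ∧ χ a ≠ 0 := by
  obtain ⟨c, hc⟩ := CharacterModule.exists_character_apply_ne_zero_of_ne_zero
    (a := (QuotientAddGroup.mk a : A ⧸ H)) (by rwa [Ne, QuotientAddGroup.eq_zero_iff])
  refine ⟨AddMonoidHom.comp (c : A ⧸ H →+ _) (QuotientAddGroup.mk' H), fun x hx => ?_, hc⟩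
  change c (QuotientAddGroup.mk x) = 0
  rw [(QuotientAddGroup.eq_zero_iff x).2 hx, map_zero]

namespace CharDual

variable {R S : Type*} [Ring R] [Ring S] [AntiHom S R]
variable {X Y Z : Type*} [AddCommGroup X] [AddCommGroup Y] [AddCommGroup Z]
variable [Module R X] [Module R Y] [Module R Z]

theorem map_surjective {f : X →ₗ[R] Y} (hf : Function.Injective f) :
    Function.Surjective (map S f) := by
  intro χ
  obtain ⟨ψ, hψ⟩ := exists_character_extension f.toAddMonoidHom hf χ
  exact ⟨ψ, ext fun x => DFunLike.congr_fun hψ x⟩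

theorem map_exact {f : X →ₗ[R] Y} {g : Y →ₗ[R] Z} (h : Function.Exact f g) :
    Function.Exact (map S g) (map S f) := by
  intro χ
  constructor
  · intro hχ
    obtain ⟨ψ, hψ⟩ := exists_character_factor g.toAddMonoidHom χ fun y hy => by
      obtain ⟨x, rfl⟩ := (h y).1 hy
      exact DFunLike.congr_fun hχ x
    exact ⟨ψ, ext fun x => DFunLike.congr_fun hψ x⟩
  · rintro ⟨ψ, rfl⟩
    refine ext fun x => ?_
    simp [h.apply_apply_eq_zero]

/-- A linear map into the dual of `X` which kills the kernel of a surjection `X → Y` comes from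
a linear map into the dual of `Y`. -/
theorem exists_descent {G : Type*} [AddCommGroup G] [Module S G] {π : X →ₗ[R] Y}
    (hπ : Function.Surjective π) (φ : G →ₗ[S] CharDual R S X)
    (h : ∀ g, ∀ x ∈ LinearMap.ker π, φ g x = 0) :
    ∃ ψ : G →ₗ[S] CharDual R S Y, ∀ g x, ψ g (π x) = φ g x := by
  have h1 : ∀ g, ∃ ψ : CharDual R S Y, map S π ψ = φ g := fun g => by
    obtain ⟨ψ, hψ⟩ := exists_character_factor π.toAddMonoidHom (φ g) (h g)
    exact ⟨ψ, ext fun x => DFunLike.congr_fun hψ x⟩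
  choose ψ hψ using h1
  refine ⟨{ toFun := ψ, map_add' := fun a b => ?_, map_smul' := fun s a => ?_ }, fun g x => ?_⟩
  · apply map_injective hπ
    rw [map_add (map S π), hψ, hψ, hψ, map_add]
  · apply map_injective hπ
    rw [RingHom.id_apply, map_smul (map S π), hψ, hψ, map_smul]
  · exact DFunLike.congr_fun (hψ g) x

variable {M : Type*} [AddCommGroup M] [Module S M] [AntiHom R S] [AntiPair R S]

/-- Exchanging the arguments of a balanced pairing. -/
def flip (f : X →ₗ[R] CharDual S R M) : M →ₗ[S] CharDual R S X where
  toFun m := AddMonoidHom.mk' (fun x => f x m) fun x y => by rw [map_add]; rfl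
  map_add' m m' := ext fun x => map_add (f x) m m'
  map_smul' s m := ext fun x => by
    change f x (s • m) = f (anti R s • x) m
    rw [f.map_smul, smul_apply, AntiPair.anti_anti_right]

@[simp] theorem flip_apply (f : X →ₗ[R] CharDual S R M) (m : M) (x : X) : flip f m x = f x m := rfl

variable (R S X) in
/-- The canonical map to the double dual. -/
def eval : X →ₗ[R] CharDual S R (CharDual R S X) where
  toFun x := AddMonoidHom.mk' (fun φ => φ x) fun _ _ => rfl
  map_add' x y := ext fun φ => map_add φ x y
  map_smul' r x := ext fun φ => by
    change φ (r • x) = (anti S r • φ) x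
    rw [smul_apply, AntiPair.anti_anti_left]

end CharDual

section

variable {R S : Type u} [Ring R] [Ring S] [AntiHom S R] [AntiHom R S] [AntiPair R S] [AntiPair S R]

/-- The character module of a projective module is injective. -/
theorem injective_charDual (P : Type u) [AddCommGroup P] [Module R P] [Module.Projective R P] :
    Module.Injective S (CharDual R S P) where
  out X Y _ _ _ _ f hf g := by
    -- A map X → P⁺ is the same as a map P → X⁺; extending the former to Y is lifting the latter
    -- along the surjection Y⁺ → X⁺.
    obtain ⟨h, hh⟩ := Module.projective_lifting_property (CharDual.map R f)
      (CharDual.flip g) (CharDual.map_surjective hf)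
    refine ⟨CharDual.flip h, fun x => CharDual.ext fun p => ?_⟩
    exact DFunLike.congr_fun (LinearMap.congr_fun hh p) x

/-- Every map from a submodule extends. -/
theorem injective_extension {Q : Type u} [AddCommGroup Q] [Module R Q] (hQ : Module.Injective R Q)
    {X Y : Type u} [AddCommGroup X] [Module R X] [AddCommGroup Y] [Module R Y]
    {i : X →ₗ[R] Y} (hi : Function.Injective i) (f : X →ₗ[R] Q) : ∃ g : Y →ₗ[R] Q, g ∘ₗ i = f := by
  obtain ⟨g, hg⟩ := hQ.out i hi f
  exact ⟨g, LinearMap.ext hg⟩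

/-- Symmetry of the extension problem for balanced pairings: for presentations `P → T` and
`G → M` by projective modules, with kernels `K` and `L`, if every pairing of `K` and `M` extends
to `P` and `M`, then every pairing of `L` and `T` extends to `G` and `T`. -/
theorem balanced_extension {P T G M : Type u} [AddCommGroup P] [Module R P] [AddCommGroup T]
    [Module R T] [AddCommGroup G] [Module S G] [AddCommGroup M] [Module S M]
    [Module.Projective R P] {π : P →ₗ[R] T} (hπ : Function.Surjective π)
    {ρ : G →ₗ[S] M} (hρ : Function.Surjective ρ)
    (H : ∀ f : LinearMap.ker π →ₗ[R] CharDual S R M, ∃ g : P →ₗ[R] CharDual S R M,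
      g ∘ₗ (LinearMap.ker π).subtype = f)
    (f : LinearMap.ker ρ →ₗ[S] CharDual R S T) : ∃ g : G →ₗ[S] CharDual R S T,
      g ∘ₗ (LinearMap.ker ρ).subtype = f := by
  -- With K = ker π and L = ker ρ, view all maps as balanced pairings. The pairing f on L × T is
  -- pulled back to L × P and extended to f₂ on G × P, since P⁺ is injective.
  obtain ⟨f₂, hf₂⟩ := injective_extension (injective_charDual (R := R) (S := S) P)
    (LinearMap.ker ρ).injective_subtype (CharDual.map S π ∘ₗ f)
  have hf₂' : ∀ (l : LinearMap.ker ρ) (p : P), f₂ l p = f l (π p) := fun l p =>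
    DFunLike.congr_fun (LinearMap.congr_fun hf₂ l) p
  -- On L × K the pairing f₂ is f(l, π k) = 0, so its restriction to G × K descends to M × K, where
  -- `H` applies.
  obtain ⟨h, hh⟩ := CharDual.exists_descent (R := S) (S := R) hρ
    (CharDual.flip f₂ ∘ₗ (LinearMap.ker π).subtype) fun k l hl => by
      have := hf₂' ⟨l, hl⟩ k
      simpa [k.2] using this
  obtain ⟨h', hh'⟩ := H h
  have hh'' : ∀ (k : LinearMap.ker π) (g : G), h' k (ρ g) = f₂ g k := fun k g => by
    rw [← hh' ] at hh
    exact hh k g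
  -- Subtracting the extended pairing kills G × K, so the difference descends to G × T. On L nothing
  -- is lost, because ρ vanishes there.
  obtain ⟨g, hg⟩ := CharDual.exists_descent hπ (f₂ - CharDual.flip h' ∘ₗ ρ) fun x p hp => by
    have := hh'' ⟨p, hp⟩ x
    simp [this]
  refine ⟨g, LinearMap.ext fun l => CharDual.ext fun t => ?_⟩
  obtain ⟨p, rfl⟩ := hπ t
  have := hg l p
  simpa [hf₂'] using this

end

end CharDual

/-! ### Extending maps into double duals -/

section DoubleDual

variable {R S : Type*} [Ring R] [Ring S] [AntiHom S R] [AntiHom R S] [AntiPair R S]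

/-- A finitely generated projective module has a finite dual basis. -/
theorem exists_finite_dual_basis (K : Type*) [AddCommGroup K] [Module R K] [Module.Finite R K]
    [Module.Projective R K] : ∃ (m : ℕ) (x : Fin m → K) (s : Fin m → K →ₗ[R] R),
      ∀ y, ∑ i, s i y • x i = y := by
  obtain ⟨m, π, hπ⟩ := Module.Finite.exists_fin' R K
  obtain ⟨σ, hσ⟩ := Module.projective_lifting_property π LinearMap.id hπ
  refine ⟨m, fun i => π (Pi.single i 1), fun i => LinearMap.proj i ∘ₗ σ, fun y => ?_⟩
  have h := LinearMap.congr_fun hσ y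
  rw [LinearMap.comp_apply, LinearMap.id_apply] at h
  conv_rhs => rw [← h, pi_eq_sum_univ' (σ y), map_sum]
  simp only [map_smul]
  rfl

/-- If maps from a finitely generated projective module `K` to `N` extend along `K → R ^ k`, then
so do maps to the double dual of `N`. -/
theorem double_dual_extension {K N : Type*} [AddCommGroup K] [Module R K] [AddCommGroup N]
    [Module R N] [Module.Finite R K] [Module.Projective R K] {k : ℕ} (ι : K →ₗ[R] (Fin k → R))
    (H : ∀ f : K →ₗ[R] N, ∃ g : (Fin k → R) →ₗ[R] N, g ∘ₗ ι = f)
    (φ : K →ₗ[R] CharDual S R (CharDual R S N)) :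
    ∃ ψ : (Fin k → R) →ₗ[R] CharDual S R (CharDual R S N), ψ ∘ₗ ι = φ := by
  obtain ⟨m, x, s, hs⟩ := exists_finite_dual_basis (R := R) K
  -- The values ψ_j on the basis of R^k must satisfy ∑_j ι(x_i)_j ψ_j = φ(x_i) for all i, that is, Ψ
  -- ∘ B = Φ as characters. This is solvable once ker B ⊆ ker Φ.
  let B : (Fin m → CharDual R S N) →+ (Fin k → CharDual R S N) :=
    AddMonoidHom.mk' (fun χ j => ∑ i, anti S (ι (x i) j) • χ i) fun χ χ' => by
      ext1 j
      simp [Finset.sum_add_distrib]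
  let Φ : (Fin m → CharDual R S N) →+ AddCircle (1 : ℚ) :=
    AddMonoidHom.mk' (fun χ => ∑ i, φ (x i) (χ i)) fun χ χ' => by
      simp [Finset.sum_add_distrib]
  have hker : ∀ χ, B χ = 0 → Φ χ = 0 := by
    intro χ hχ
    have h1 : ∀ g : K →ₗ[R] N, ∑ i, χ i (g (x i)) = 0 := by
      intro g
      obtain ⟨g', rfl⟩ := H g
      have h2 : ∀ i, χ i ((g' ∘ₗ ι) (x i)) =
          ∑ j, (anti S (ι (x i) j) • χ i) (g' (Pi.single j 1)) := by
        intro i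
        rw [LinearMap.comp_apply]
        conv_lhs => rw [pi_eq_sum_univ' (ι (x i)), map_sum, map_sum]
        refine Finset.sum_congr rfl fun j _ => ?_
        rw [map_smul, CharDual.smul_apply, AntiPair.anti_anti_left]
      rw [Finset.sum_congr rfl fun i _ => h2 i, Finset.sum_comm]
      refine Finset.sum_eq_zero fun j _ => ?_
      have h3 := DFunLike.congr_fun (congrFun hχ j) (g' (Pi.single j 1))
      exact (CharDual.sum_apply _ _ _).symm.trans h3
    -- The preceding vanishing is tested on the maps y ↦ s_l(y) v, for all v in N.
    have h4 : ∀ l, ∑ i, anti S (s l (x i)) • χ i = 0 := by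
      intro l
      refine CharDual.ext fun v => ?_
      have h5 := h1 (LinearMap.toSpanSingleton R N v ∘ₗ s l)
      simpa [AntiPair.anti_anti_left] using h5
    calc ∑ i, φ (x i) (χ i) = ∑ i, ∑ l, φ (x l) (anti S (s l (x i)) • χ i) := by
          refine Finset.sum_congr rfl fun i _ => ?_
          conv_lhs => rw [← hs (x i), map_sum, CharDual.sum_apply]
          refine Finset.sum_congr rfl fun l _ => ?_
          rw [map_smul, CharDual.smul_apply]
      _ = 0 := by
          rw [Finset.sum_comm]
          refine Finset.sum_eq_zero fun l _ => ?_
          rw [← map_sum, h4, map_zero]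
  obtain ⟨Ψ, hΨ⟩ := exists_character_factor B Φ hker
  let ψ : Fin k → CharDual S R (CharDual R S N) := fun j =>
    Ψ.comp (AddMonoidHom.single (fun _ : Fin k => CharDual R S N) j)
  have hψ : ∀ j χ, ψ j χ = Ψ (Pi.single j χ) := fun j χ => rfl
  refine ⟨Fintype.linearCombination R ψ, ?_⟩
  have hx : ∀ i, Fintype.linearCombination R ψ (ι (x i)) = φ (x i) := by
    intro i
    refine CharDual.ext fun χ => ?_
    have h6 := DFunLike.congr_fun hΨ (Pi.single i χ)
    have h7 : B (Pi.single i χ) = ∑ j, Pi.single j (anti S (ι (x i) j) • χ) := by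
      rw [Finset.univ_sum_single (fun j => anti S (ι (x i) j) • χ)]
      ext1 j
      change ∑ i', anti S (ι (x i') j) • (Pi.single i χ : Fin m → CharDual R S N) i' = _
      rw [Finset.sum_eq_single i]
      · simp
      · intro b _ hb
        simp [hb]
      · simp
    have h8 : Φ (Pi.single i χ) = φ (x i) χ := by
      change ∑ i', φ (x i') ((Pi.single i χ : Fin m → CharDual R S N) i') = _
      rw [Finset.sum_eq_single i]
      · simp
      · intro b _ hb
        simp [hb]
      · simp
    rw [AddMonoidHom.comp_apply, h7, h8, map_sum] at h6
    rw [Fintype.linearCombination_apply, CharDual.sum_apply, ← h6]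
    exact Finset.sum_congr rfl fun j _ => rfl
  refine LinearMap.ext fun y => ?_
  rw [LinearMap.comp_apply, ← hs y]
  simp only [map_sum, map_smul, hx]

/-- A finitely presented module is projective if every map from the module of relations to its
double dual extends to the generators. -/
theorem projective_of_double_dual_extension {K : Type*} [AddCommGroup K] [Module R K] {m : ℕ}
    {π : (Fin m → R) →ₗ[R] K} (hπ : Function.Surjective π)
    [Module.Finite R (LinearMap.ker π)]
    (H : ∀ f : LinearMap.ker π →ₗ[R] CharDual S R (CharDual R S (LinearMap.ker π)),
      ∃ g : (Fin m → R) →ₗ[R] CharDual S R (CharDual R S (LinearMap.ker π)),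
        g ∘ₗ (LinearMap.ker π).subtype = f) : Module.Projective R K := by
  set L := LinearMap.ker π
  obtain ⟨p, l, hl⟩ := Module.Finite.exists_fin (R := R) (M := L)
  let A : (Fin m → L) →+ (Fin p → L) :=
    AddMonoidHom.mk' (fun v i => ∑ j, (l i : Fin m → R) j • v j) fun v v' => by
      ext1 i
      simp [Finset.sum_add_distrib]
  -- A preimage v of the generators l under A is a retraction R^m → L, sending the basis to v. The
  -- extension of the evaluation map shows that any character killing the range of A kills l as
  -- well.
  have hA : l ∈ A.range := by
    by_contra hcon
    obtain ⟨θ, hθ, hθl⟩ := exists_character_separating A.range hcon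
    let t : Fin p → CharDual R S L := fun i =>
      θ.comp (AddMonoidHom.single (fun _ : Fin p => L) i)
    have ht : ∀ i v, t i v = θ (Pi.single i v) := fun _ _ => rfl
    obtain ⟨g, hg⟩ := H (CharDual.eval R S L)
    apply hθl
    have h1 : ∀ j, ∑ i, anti S ((l i : Fin m → R) j) • t i = 0 := by
      intro j
      refine CharDual.ext fun v => ?_
      have h2 := hθ (A (Pi.single j v)) ⟨_, rfl⟩
      have h3 : A (Pi.single j v) = ∑ i, Pi.single i ((l i : Fin m → R) j • v) := by
        rw [Finset.univ_sum_single (fun i => (l i : Fin m → R) j • v)]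
        ext1 i
        change ∑ j', (l i : Fin m → R) j' • (Pi.single j v : Fin m → L) j' = _
        rw [Finset.sum_eq_single j]
        · simp
        · intro b _ hb
          simp [hb]
        · simp
      rw [h3, map_sum] at h2
      rw [CharDual.sum_apply, CharDual.zero_apply, ← h2]
      refine Finset.sum_congr rfl fun i _ => ?_
      rw [CharDual.smul_apply, AntiPair.anti_anti_left, ht]
    have h4 : ∀ i, t i (l i) = ∑ j, g (Pi.single j 1) (anti S ((l i : Fin m → R) j) • t i) := by
      intro i
      have h5 : g (l i : Fin m → R) (t i) = t i (l i) :=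
        DFunLike.congr_fun (LinearMap.congr_fun hg (l i)) (t i)
      rw [← h5]
      conv_lhs => rw [pi_eq_sum_univ' (l i : Fin m → R), map_sum, CharDual.sum_apply]
      refine Finset.sum_congr rfl fun j _ => ?_
      rw [map_smul, CharDual.smul_apply]
    have h6 : θ l = ∑ i, t i (l i) := by
      conv_lhs => rw [← Finset.univ_sum_single l, map_sum]
      rfl
    rw [h6, Finset.sum_congr rfl fun i _ => h4 i, Finset.sum_comm]
    refine Finset.sum_eq_zero fun j _ => ?_
    rw [← map_sum, h1, map_zero]
  obtain ⟨v, hv⟩ := hA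
  let g : (Fin m → R) →ₗ[R] L := Fintype.linearCombination R v
  have hg : g ∘ₗ L.subtype = LinearMap.id := by
    refine LinearMap.ext_on_range hl fun i => ?_
    rw [LinearMap.comp_apply, LinearMap.id_apply]
    conv_rhs => rw [← hv]
    rfl
  -- The projection 1 - g vanishes on L, so it descends to a section of π.
  let e : (Fin m → R) →ₗ[R] (Fin m → R) := LinearMap.id - L.subtype ∘ₗ g
  have he : L ≤ LinearMap.ker e := fun y hy => by
    have := LinearMap.congr_fun hg ⟨y, hy⟩
    have h7 : g y = ⟨y, hy⟩ := this
    simp [e, h7]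
  refine Module.Projective.of_split (L.liftQ e he ∘ₗ
    (π.quotKerEquivOfSurjective hπ).symm.toLinearMap) π ?_
  refine LinearMap.ext fun y => ?_
  obtain ⟨z, rfl⟩ := hπ y
  have h8 : (π.quotKerEquivOfSurjective hπ).symm (π z) = Submodule.Quotient.mk z := by
    rw [LinearEquiv.symm_apply_eq]
    rfl
  rw [LinearMap.comp_apply, LinearMap.comp_apply, LinearEquiv.coe_coe, h8, LinearMap.id_apply]
  change π (z - (g z : Fin m → R)) = π z
  rw [map_sub, show π (g z : Fin m → R) = 0 from (g z).2, sub_zero]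

end DoubleDual

/-! ### `Ext¹` as an obstruction to extending and lifting maps -/

section Ext

variable {R : Type u} [Ring R]

theorem exists_extension_of_subsingleton_ext {S : ShortComplex (ModuleCat.{u} R)}
    (hS : S.ShortExact) {X : ModuleCat.{u} R} (h : Subsingleton (Abelian.Ext S.X₃ X 1))
    (f : S.X₁ ⟶ X) : ∃ g : S.X₂ ⟶ X, S.f ≫ g = f := by
  obtain ⟨x, hx⟩ := Abelian.Ext.contravariant_sequence_exact₁ hS X (Abelian.Ext.mk₀ f)
    (add_zero 1) (Subsingleton.elim _ _)
  obtain ⟨g, rfl⟩ := (Abelian.Ext.mk₀_bijective _ _).2 x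
  refine ⟨g, (Abelian.Ext.mk₀_bijective _ _).1 ?_⟩
  rw [← hx, Abelian.Ext.mk₀_comp_mk₀]

theorem subsingleton_ext_one_iff_extension {S : ShortComplex (ModuleCat.{u} R)}
    (hS : S.ShortExact) [Projective S.X₂] (X : ModuleCat.{u} R) :
    Subsingleton (Abelian.Ext S.X₃ X 1) ↔ ∀ f : S.X₁ ⟶ X, ∃ g : S.X₂ ⟶ X, S.f ≫ g = f := by
  refine ⟨exists_extension_of_subsingleton_ext hS, ?_⟩
  · intro h
    refine subsingleton_of_forall_eq 0 fun x => ?_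
    obtain ⟨y, rfl⟩ := Abelian.Ext.contravariant_sequence_exact₃ hS X x
      (Abelian.Ext.eq_zero_of_projective _) (add_zero 1)
    obtain ⟨f, rfl⟩ := (Abelian.Ext.mk₀_bijective _ _).2 y
    obtain ⟨g, rfl⟩ := h f
    rw [← Abelian.Ext.mk₀_comp_mk₀]
    exact hS.extClass_comp_assoc (Abelian.Ext.mk₀ g)

theorem subsingleton_ext_one_iff_lift {S : ShortComplex (ModuleCat.{u} R)}
    (hS : S.ShortExact) [Injective S.X₂] (X : ModuleCat.{u} R) :
    Subsingleton (Abelian.Ext X S.X₁ 1) ↔ ∀ f : X ⟶ S.X₃, ∃ g : X ⟶ S.X₂, g ≫ S.g = f := by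
  constructor
  · intro h f
    obtain ⟨x, hx⟩ := Abelian.Ext.covariant_sequence_exact₃ X hS (Abelian.Ext.mk₀ f)
      (zero_add 1) (Subsingleton.elim _ _)
    obtain ⟨g, rfl⟩ := (Abelian.Ext.mk₀_bijective _ _).2 x
    refine ⟨g, (Abelian.Ext.mk₀_bijective _ _).1 ?_⟩
    rw [← hx, Abelian.Ext.mk₀_comp_mk₀]
  · intro h
    refine subsingleton_of_forall_eq 0 fun x => ?_
    obtain ⟨y, rfl⟩ := Abelian.Ext.covariant_sequence_exact₁ X hS x
      (Abelian.Ext.eq_zero_of_injective _) (zero_add 1)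
    obtain ⟨f, rfl⟩ := (Abelian.Ext.mk₀_bijective _ _).2 y
    obtain ⟨g, rfl⟩ := h f
    rw [← Abelian.Ext.mk₀_comp_mk₀, Abelian.Ext.comp_assoc_of_second_deg_zero, hS.comp_extClass,
      Abelian.Ext.comp_zero]

/-- The short complex of an exact pair of linear maps. -/
abbrev seqOfExact {A B C : Type u} [AddCommGroup A] [Module R A] [AddCommGroup B] [Module R B]
    [AddCommGroup C] [Module R C] (f : A →ₗ[R] B) (g : B →ₗ[R] C) (h : Function.Exact f g) :
    ShortComplex (ModuleCat.{u} R) :=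
  ShortComplex.mk (ModuleCat.ofHom f) (ModuleCat.ofHom g)
    (ModuleCat.hom_ext (LinearMap.ext h.apply_apply_eq_zero))

theorem shortExact_seqOfExact {A B C : Type u} [AddCommGroup A] [Module R A] [AddCommGroup B]
    [Module R B] [AddCommGroup C] [Module R C] {f : A →ₗ[R] B} {g : B →ₗ[R] C}
    (hf : Function.Injective f) (h : Function.Exact f g) (hg : Function.Surjective g) :
    (seqOfExact f g h).ShortExact :=
  ModuleCat.shortComplex_shortExact _ h hf hg

theorem exact_ker_subtype {P F : Type u} [AddCommGroup P] [Module R P] [AddCommGroup F]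
    [Module R F] (π : P →ₗ[R] F) : Function.Exact (LinearMap.ker π).subtype π :=
  LinearMap.exact_subtype_ker_map π

theorem ext_one_iff {P F : Type u} [AddCommGroup P] [Module R P] [AddCommGroup F]
    [Module R F] [Module.Projective R P] {π : P →ₗ[R] F} (hπ : Function.Surjective π)
    (X : Type u) [AddCommGroup X] [Module R X] :
    Subsingleton (Abelian.Ext (ModuleCat.of R F) (ModuleCat.of R X) 1) ↔
      ∀ f : LinearMap.ker π →ₗ[R] X, ∃ g : P →ₗ[R] X, g ∘ₗ (LinearMap.ker π).subtype = f := by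
  have : Projective (ModuleCat.of R P) := (IsProjective.iff_projective P).1 inferInstance
  have : Projective (seqOfExact _ _ (exact_ker_subtype π)).X₂ := this
  refine (subsingleton_ext_one_iff_extension (shortExact_seqOfExact
    (LinearMap.ker π).injective_subtype (exact_ker_subtype π) hπ) (ModuleCat.of R X)).trans ?_
  constructor
  · intro h f
    obtain ⟨g, hg⟩ := h (ModuleCat.ofHom f)
    exact ⟨g.hom, congrArg ModuleCat.Hom.hom hg⟩
  · intro h f
    obtain ⟨g, hg⟩ := h f.hom
    exact ⟨ModuleCat.ofHom g, ModuleCat.hom_ext hg⟩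

theorem subsingleton_ext_of_subsingleton_of_iso {X X' Y Y' : ModuleCat.{u} R} (e : X ≅ X')
    (e' : Y ≅ Y') (n : ℕ) (h : Subsingleton (Abelian.Ext X Y n)) :
    Subsingleton (Abelian.Ext X' Y' n) := by
  refine subsingleton_of_forall_eq 0 fun x => ?_
  have h1 : x = (Abelian.Ext.mk₀ e.inv).comp (((Abelian.Ext.mk₀ e.hom).comp
      (x.comp (Abelian.Ext.mk₀ e'.inv) (add_zero n)) (zero_add n)).comp
        (Abelian.Ext.mk₀ e'.hom) (add_zero n)) (zero_add n) := by
    simp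
  rw [h1, Subsingleton.elim ((Abelian.Ext.mk₀ e.hom).comp
      (x.comp (Abelian.Ext.mk₀ e'.inv) (add_zero n)) (zero_add n)) 0]
  simp

/-- `Ext²(F, -)` vanishes on the kernel of an epimorphism from an injective object onto `Z`
if and only if `Ext¹(F, Z)` vanishes. -/
theorem subsingleton_ext_two_iff {S : ShortComplex (ModuleCat.{u} R)} (hS : S.ShortExact)
    [Injective S.X₂] (F : ModuleCat.{u} R) :
    Subsingleton (Abelian.Ext F S.X₁ 2) ↔ Subsingleton (Abelian.Ext F S.X₃ 1) := by
  constructor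
  · intro h
    refine subsingleton_of_forall_eq 0 fun x => ?_
    obtain ⟨y, rfl⟩ := Abelian.Ext.covariant_sequence_exact₃ F hS x
      (one_add_one_eq_two) (Subsingleton.elim _ _)
    rw [Abelian.Ext.eq_zero_of_injective y, Abelian.Ext.zero_comp]
  · intro h
    refine subsingleton_of_forall_eq 0 fun x => ?_
    obtain ⟨y, rfl⟩ := Abelian.Ext.covariant_sequence_exact₁ F hS x
      (Abelian.Ext.eq_zero_of_injective _) (one_add_one_eq_two)
    rw [Subsingleton.elim y 0, Abelian.Ext.zero_comp]

/-- `Ext²(F, X) = 0` implies `Ext¹(K, X) = 0` for a syzygy `K` of `F`. -/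
theorem subsingleton_ext_one_of_ext_two {S : ShortComplex (ModuleCat.{u} R)} (hS : S.ShortExact)
    [Projective S.X₂] (X : ModuleCat.{u} R) (h : Subsingleton (Abelian.Ext S.X₃ X 2)) :
    Subsingleton (Abelian.Ext S.X₁ X 1) := by
  refine subsingleton_of_forall_eq 0 fun x => ?_
  obtain ⟨y, rfl⟩ := Abelian.Ext.contravariant_sequence_exact₁ hS X x
    (one_add_one_eq_two) (Subsingleton.elim _ _)
  rw [Abelian.Ext.eq_zero_of_projective y, Abelian.Ext.comp_zero]

/-- An object whose `Ext²` vanishes has projective dimension at most one. -/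
theorem hasProjectiveDimensionLE_one_of_quotient_closed (T : ModuleCat.{u} R)
    (h : ∀ (S : ShortComplex (ModuleCat.{u} R)), S.ShortExact → Injective S.X₂ →
      Subsingleton (Abelian.Ext T S.X₃ 1)) : HasProjectiveDimensionLE T 1 := by
  refine hasProjectiveDimensionLT_of_enoughInjectives T 2 fun Y => ?_
  -- For an embedding of Y in an injective J, Ext²(T, Y) vanishes as soon as Ext¹(T, J/Y) does.
  obtain ⟨p⟩ := EnoughInjectives.presentation Y
  have hS : (ShortComplex.mk _ _ (Limits.cokernel.condition p.f)).ShortExact :=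
    { exact := ShortComplex.exact_cokernel p.f }
  exact (subsingleton_ext_two_iff hS T).2 (h _ hS p.injective)

/-- The right orthogonal class of a module of projective dimension at most one is closed under
quotients. -/
theorem subsingleton_ext_one_quotient {T : ModuleCat.{u} R} (hT : HasProjectiveDimensionLE T 1)
    {S : ShortComplex (ModuleCat.{u} R)} (hS : S.ShortExact)
    (h : Subsingleton (Abelian.Ext T S.X₂ 1)) : Subsingleton (Abelian.Ext T S.X₃ 1) := by
  refine subsingleton_of_forall_eq 0 fun x => ?_
  have := HasProjectiveDimensionLT.subsingleton T 2 2 le_rfl S.X₁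
  obtain ⟨y, rfl⟩ := Abelian.Ext.covariant_sequence_exact₃ T hS x
    (one_add_one_eq_two) (Subsingleton.elim _ _)
  rw [Subsingleton.elim y 0, Abelian.Ext.zero_comp]

/-- The left orthogonal class of a module of injective dimension at most one is closed under
submodules. -/
theorem subsingleton_ext_one_sub {C : ModuleCat.{u} R} (hC : HasInjectiveDimensionLE C 1)
    {S : ShortComplex (ModuleCat.{u} R)} (hS : S.ShortExact)
    (h : Subsingleton (Abelian.Ext S.X₂ C 1)) : Subsingleton (Abelian.Ext S.X₁ C 1) := by
  refine subsingleton_of_forall_eq 0 fun x => ?_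
  have := HasInjectiveDimensionLT.subsingleton C 2 2 le_rfl S.X₃
  obtain ⟨y, rfl⟩ := Abelian.Ext.contravariant_sequence_exact₁ hS C x
    (one_add_one_eq_two) (Subsingleton.elim _ _)
  rw [Subsingleton.elim y 0, Abelian.Ext.comp_zero]

end Ext

/-! ### `Tor` and character modules -/

section Tor

/-- Holds because ℚ/ℤ is an injective cogenerator of abelian groups; it turns exactness after
tensoring into a factorization problem for maps. -/
theorem exact_iff_characters {A B C : Type*} [AddCommGroup A] [AddCommGroup B] [AddCommGroup C]
    (a : A →+ B) (b : B →+ C) (hab : ∀ x, b (a x) = 0) :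
    Function.Exact a b ↔ ∀ χ : B →+ AddCircle (1 : ℚ), χ.comp a = 0 →
      ∃ ψ : C →+ AddCircle (1 : ℚ), ψ.comp b = χ := by
  constructor
  · intro h χ hχ
    refine exists_character_factor b χ fun y hy => ?_
    obtain ⟨x, rfl⟩ := (h y).1 hy
    exact DFunLike.congr_fun hχ x
  · intro h y
    constructor
    · intro hy
      by_contra hcon
      obtain ⟨χ, hχ, hχy⟩ := exists_character_separating a.range (a := y) hcon
      obtain ⟨ψ, rfl⟩ := h χ (AddMonoidHom.ext fun x => hχ _ ⟨x, rfl⟩)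
      exact hχy (by rw [AddMonoidHom.comp_apply, hy, map_zero])
    · rintro ⟨x, rfl⟩
      exact hab x

variable {R : Type u} [Ring R]

/-- The linear map into the character module corresponding to a character of the tensor
product. -/
def charCurry {M : ModuleCat.{u} Rᵐᵒᵖ} {N : ModuleCat.{u} R}
    (χ : TensorOver M N →+ AddCircle (1 : ℚ)) : N →ₗ[R] CharDual Rᵐᵒᵖ R M where
  toFun x := AddMonoidHom.mk' (fun m => χ (QuotientAddGroup.mk (m ⊗ₜ[ℤ] x))) fun m m' => by
    rw [TensorProduct.add_tmul, QuotientAddGroup.mk_add, map_add]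
  map_add' x y := CharDual.ext fun m => by
    change χ (QuotientAddGroup.mk (m ⊗ₜ[ℤ] (x + y))) = _
    rw [TensorProduct.tmul_add, QuotientAddGroup.mk_add, map_add]
    rfl
  map_smul' r x := CharDual.ext fun m => by
    change χ (QuotientAddGroup.mk (m ⊗ₜ[ℤ] (r • x))) =
      χ (QuotientAddGroup.mk ((op r • m) ⊗ₜ[ℤ] x))
    refine congrArg χ (QuotientAddGroup.eq.2 ?_)
    rw [neg_add_eq_sub]
    exact AddSubgroup.subset_closure ⟨m, r, x, rfl⟩

theorem charCurry_injective {M : ModuleCat.{u} Rᵐᵒᵖ} {N : ModuleCat.{u} R} :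
    Function.Injective (charCurry (M := M) (N := N)) := fun _ _ h =>
  tensorOver_hom_ext fun m x => DFunLike.congr_fun (LinearMap.congr_fun h x) m

theorem charCurry_surjective {M : ModuleCat.{u} Rᵐᵒᵖ} {N : ModuleCat.{u} R} :
    Function.Surjective (charCurry (M := M) (N := N)) := by
  intro f
  let b : M →+ N →+ AddCircle (1 : ℚ) := AddMonoidHom.mk'
    (fun m => AddMonoidHom.mk' (fun x => f x m) fun x y => by rw [map_add]; rfl)
    fun m m' => AddMonoidHom.ext fun x => map_add (f x) m m'
  refine ⟨QuotientAddGroup.lift _ (TensorProduct.liftAddHom b fun z m x => ?_) ?_, ?_⟩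
  · rw [map_zsmul, map_zsmul]
    rfl
  · refine (AddSubgroup.closure_le _).2 ?_
    rintro _ ⟨m, r, x, rfl⟩
    change _ = _
    rw [map_sub, TensorProduct.liftAddHom_tmul, TensorProduct.liftAddHom_tmul, sub_eq_zero]
    change f x (op r • m) = f (r • x) m
    rw [f.map_smul]
    rfl
  · rfl

theorem charCurry_comp {M : ModuleCat.{u} Rᵐᵒᵖ} {N N' : ModuleCat.{u} R} (f : N ⟶ N')
    (χ : TensorOver M N' →+ AddCircle (1 : ℚ)) :
    charCurry (χ.comp (tensorMap M f)) = charCurry χ ∘ₗ f.hom := rfl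

theorem charCurry_zero {M : ModuleCat.{u} Rᵐᵒᵖ} {N : ModuleCat.{u} R} :
    charCurry (0 : TensorOver M N →+ AddCircle (1 : ℚ)) = 0 := rfl

/-- The adjunction Hom(M ⊗_R N, ℚ/ℤ) ≅ Hom_R(N, M⁺), given by `charCurry`, translates the character
test for exactness. -/
theorem exact_tensorMap_iff (M : ModuleCat.{u} Rᵐᵒᵖ) {A B C : ModuleCat.{u} R} (a : A ⟶ B)
    (b : B ⟶ C) (hab : a ≫ b = 0) :
    Function.Exact (tensorMap M a) (tensorMap M b) ↔
      ∀ χ : B →ₗ[R] CharDual Rᵐᵒᵖ R M, χ ∘ₗ a.hom = 0 →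
        ∃ ψ : C →ₗ[R] CharDual Rᵐᵒᵖ R M, ψ ∘ₗ b.hom = χ := by
  have h0 : (tensorMap M b).comp (tensorMap M a) = 0 := by
    refine tensorOver_hom_ext fun m x => ?_
    have : b.hom (a.hom x) = 0 := congrArg (fun f : A ⟶ C => f.hom x) hab
    rw [AddMonoidHom.comp_apply, tensorMap_mk_tmul, tensorMap_mk_tmul, this,
      TensorProduct.tmul_zero]
    rfl
  rw [exact_iff_characters _ _ fun x => DFunLike.congr_fun h0 x]
  constructor
  · intro h χ hχ
    obtain ⟨χ, rfl⟩ := charCurry_surjective χ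
    obtain ⟨ψ, rfl⟩ := h χ (charCurry_injective (by rw [charCurry_comp, hχ, charCurry_zero]))
    exact ⟨charCurry ψ, rfl⟩
  · intro h χ hχ
    obtain ⟨ψ, hψ⟩ := h (charCurry χ) (by rw [← charCurry_comp, hχ, charCurry_zero])
    obtain ⟨ψ, rfl⟩ := charCurry_surjective ψ
    exact ⟨ψ, charCurry_injective hψ⟩

theorem exists_factor_of_surjective {A B X : Type*} [AddCommGroup A] [Module R A]
    [AddCommGroup B] [Module R B] [AddCommGroup X] [Module R X] {δ : A →ₗ[R] B}
    (hδ : Function.Surjective δ) (χ : A →ₗ[R] X) (h : LinearMap.ker δ ≤ LinearMap.ker χ) :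
    ∃ f : B →ₗ[R] X, f ∘ₗ δ = χ := by
  refine ⟨(LinearMap.ker δ).liftQ χ h ∘ₗ (δ.quotKerEquivOfSurjective hδ).symm.toLinearMap, ?_⟩
  refine LinearMap.ext fun y => ?_
  have h8 : (δ.quotKerEquivOfSurjective hδ).symm (δ y) = Submodule.Quotient.mk y := by
    rw [LinearEquiv.symm_apply_eq]
    rfl
  rw [LinearMap.comp_apply, LinearMap.comp_apply, LinearEquiv.coe_coe, h8]
  rfl

/-- A map on P₁ killing the image of d₂ is the same as a map on ker π = P₁ / im d₂. This links the
cocycle condition from a resolution with the extension form of Ext¹. -/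
theorem extension_iff_of_exact {P₂ P₁ P₀ F X : Type u} [AddCommGroup P₂] [Module R P₂]
    [AddCommGroup P₁] [Module R P₁] [AddCommGroup P₀] [Module R P₀] [AddCommGroup F] [Module R F]
    [AddCommGroup X] [Module R X] (d₂ : P₂ →ₗ[R] P₁) (d₁ : P₁ →ₗ[R] P₀) (π : P₀ →ₗ[R] F)
    (h₂ : Function.Exact d₂ d₁) (h₁ : Function.Exact d₁ π) :
    (∀ χ : P₁ →ₗ[R] X, χ ∘ₗ d₂ = 0 → ∃ ψ : P₀ →ₗ[R] X, ψ ∘ₗ d₁ = χ) ↔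
      ∀ f : LinearMap.ker π →ₗ[R] X, ∃ g : P₀ →ₗ[R] X, g ∘ₗ (LinearMap.ker π).subtype = f := by
  let δ : P₁ →ₗ[R] LinearMap.ker π := d₁.codRestrict _ h₁.apply_apply_eq_zero
  have hδ : Function.Surjective δ := fun ⟨y, hy⟩ => by
    obtain ⟨x, rfl⟩ := (h₁ y).1 hy
    exact ⟨x, rfl⟩
  constructor
  · intro h f
    obtain ⟨ψ, hψ⟩ := h (f ∘ₗ δ) (LinearMap.ext fun x => by
      have : δ (d₂ x) = 0 := Subtype.ext (h₂.apply_apply_eq_zero x)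
      simp [this])
    refine ⟨ψ, LinearMap.ext fun y => ?_⟩
    obtain ⟨x, rfl⟩ := hδ y
    exact LinearMap.congr_fun hψ x
  · intro h χ hχ
    obtain ⟨f, rfl⟩ := exists_factor_of_surjective hδ χ fun x hx => by
      obtain ⟨z, rfl⟩ := (h₂ x).1 (congrArg Subtype.val hx)
      exact LinearMap.congr_fun hχ z
    obtain ⟨g, rfl⟩ := h f
    exact ⟨g, rfl⟩

/-- `Tor₁(M, F)` vanishes if and only if `Ext¹(F, M⁺)` does. -/
theorem subsingleton_tor_one_iff (M : ModuleCat.{u} Rᵐᵒᵖ) (F : ModuleCat.{u} R) :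
    Subsingleton (Tor 1 M F) ↔
      Subsingleton (Abelian.Ext F (ModuleCat.of R (CharDual Rᵐᵒᵖ R M)) 1) := by
  let P : ProjectiveResolution F := projectiveResolution F
  let e := P.isoLeftDerivedObj (tensorFunctor M) 1
  let π : P.complex.X 0 ⟶ F := P.π.f 0
  have hπ : Function.Surjective π.hom := (ModuleCat.epi_iff_surjective π).1
    (inferInstanceAs (Epi (P.π.f 0)))
  have hproj : Module.Projective R (P.complex.X 0) :=
    (IsProjective.iff_projective _).2 (P.projective 0)
  have h₁ : Function.Exact (P.complex.d 1 0).hom π.hom :=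
    (ShortComplex.ShortExact.moduleCat_exact_iff_function_exact _).1 P.exact₀
  have h₂ : Function.Exact (P.complex.d 2 1).hom (P.complex.d 1 0).hom :=
    (ShortComplex.ShortExact.moduleCat_exact_iff_function_exact _).1 (P.exact_succ 0)
  -- Tor₁ is the degree 1 homology of M ⊗ P, so it vanishes iff that complex is exact there.
  have key : Subsingleton (Tor 1 M F) ↔ Function.Exact (tensorMap M (P.complex.d 2 1))
      (tensorMap M (P.complex.d 1 0)) := by
    rw [← AddCommGrpCat.isZero_iff_subsingleton (G := Tor 1 M F)]
    refine (e.isZero_iff).trans ?_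
    refine (HomologicalComplex.exactAt_iff_isZero_homology _ _).symm.trans ?_
    refine (HomologicalComplex.exactAt_iff' _ 2 1 0 (by simp) (by simp)).trans ?_
    exact ShortComplex.ab_exact_iff_function_exact _
  rw [key, exact_tensorMap_iff _ _ _ (P.complex.d_comp_d 2 1 0),
    extension_iff_of_exact _ _ π.hom h₂ h₁]
  exact (ext_one_iff hπ _).symm

end Tor

/-! ### Finitely `n`-presented modules -/

section FinitelyPresented

variable {R : Type*} [Ring R]

theorem IsFinitelyNPresented.of_equiv {n : ℕ} {M N : Type*} [AddCommGroup M] [Module R M]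
    [AddCommGroup N] [Module R N] (h : IsFinitelyNPresented R n M) (e : M ≃ₗ[R] N) :
    IsFinitelyNPresented R n N := by
  obtain ⟨k, d, ε, hε, h₀, h₁⟩ := h
  refine ⟨k, d, e.toLinearMap ∘ₗ ε, e.surjective.comp hε, fun hn x => ?_, h₁⟩
  rw [← h₀ hn x]
  simp

theorem IsFinitelyNPresented.finite {n : ℕ} {M : Type*} [AddCommGroup M] [Module R M]
    (h : IsFinitelyNPresented R n M) : Module.Finite R M := by
  obtain ⟨k, d, ε, hε, -, -⟩ := h
  exact Module.Finite.of_surjective ε hε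

theorem IsFinitelyNPresented.exists_presentation {n : ℕ} {M : Type*} [AddCommGroup M] [Module R M]
    (h : IsFinitelyNPresented R (n + 1) M) : ∃ (k : ℕ) (π : (Fin k → R) →ₗ[R] M),
      Function.Surjective π ∧ IsFinitelyNPresented R n (LinearMap.ker π) := by
  obtain ⟨k, d, ε, hε, h₀, h₁⟩ := h
  have h₀' := h₀ n.succ_pos
  refine ⟨k 0, ε, hε, fun i => k (i + 1), fun i => d (i + 1),
    (d 0).codRestrict _ h₀'.apply_apply_eq_zero, ?_, fun hn x => ?_,
    fun i hi => h₁ (i + 1) (by omega)⟩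
  · rintro ⟨y, hy⟩
    obtain ⟨x, rfl⟩ := (h₀' y).1 hy
    exact ⟨x, rfl⟩
  · rw [← h₁ 0 (by omega) x, Subtype.ext_iff]
    rfl

/-- The ranks in a resolution extended by one term. -/
def consRank (k : ℕ) (l : ℕ → ℕ) : ℕ → ℕ
  | 0 => k
  | i + 1 => l i

/-- The differentials in a resolution extended by one term. -/
def consDiff {k : ℕ} {l : ℕ → ℕ} (ε : (Fin (l 0) → R) →ₗ[R] (Fin k → R))
    (d : ∀ i : ℕ, (Fin (l (i + 1)) → R) →ₗ[R] (Fin (l i) → R)) :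
    ∀ i : ℕ, (Fin (consRank k l (i + 1)) → R) →ₗ[R] (Fin (consRank k l i) → R)
  | 0 => ε
  | i + 1 => d i

theorem IsFinitelyNPresented.of_presentation {n : ℕ} {M : Type*} [AddCommGroup M] [Module R M]
    {k : ℕ} {π : (Fin k → R) →ₗ[R] M} (hπ : Function.Surjective π)
    (h : IsFinitelyNPresented R n (LinearMap.ker π)) : IsFinitelyNPresented R (n + 1) M := by
  obtain ⟨l, d, ε, hε, h₀, h₁⟩ := h
  refine ⟨consRank k l, consDiff ((LinearMap.ker π).subtype ∘ₗ ε) d, π, hπ, fun _ x => ?_, ?_⟩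
  · constructor
    · intro hx
      obtain ⟨y, hy⟩ := hε ⟨x, hx⟩
      exact ⟨y, congrArg Subtype.val hy⟩
    · rintro ⟨y, rfl⟩
      exact (ε y).2
  · rintro (_ | i) hi
    · intro x
      exact Submodule.coe_eq_zero.trans (h₀ (by omega) x)
    · exact h₁ i (by omega)

end FinitelyPresented

/-! ### Reduction of n-heredity to syzygies in free modules -/

section Hereditary

variable {R : Type u} [Ring R]

theorem IsNHereditary.projective_ker {n : ℕ} (h : IsNHereditary R (n + 1)) {k : ℕ} {F : Type u}
    [AddCommGroup F] [Module R F] (π : (Fin k → R) →ₗ[R] F)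
    (hπ : IsFinitelyNPresented R n (LinearMap.ker π)) : Module.Projective R (LinearMap.ker π) :=
  h (Fin k → R) (LinearMap.ker π) fun _ => hπ

/-- A finitely generated projective P embeds in some R^k by a section, and N becomes the kernel of
the quotient map by its image. -/
theorem isNHereditary_of_projective_ker {n : ℕ} (h : ∀ (k : ℕ) (F : Type u) [AddCommGroup F]
    [Module R F] (π : (Fin k → R) →ₗ[R] F), Function.Surjective π →
      IsFinitelyNPresented R n (LinearMap.ker π) → Module.Projective R (LinearMap.ker π)) :
    IsNHereditary R (n + 1) := by
  intro P _ _ _ _ N hN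
  obtain ⟨k, p, hp⟩ := Module.Finite.exists_fin' R P
  obtain ⟨s, hs⟩ := Module.projective_lifting_property p LinearMap.id hp
  have hsi : Function.Injective s :=
    Function.LeftInverse.injective (g := p) fun x => LinearMap.congr_fun hs x
  let e : N ≃ₗ[R] LinearMap.ker (N.map s).mkQ :=
    (Submodule.equivMapOfInjective s hsi N).trans (LinearEquiv.ofEq _ _ (Submodule.ker_mkQ _).symm)
  have := h k _ (N.map s).mkQ (Submodule.mkQ_surjective _) ((hN (by omega)).of_equiv e)
  exact Module.Projective.of_equiv e.symm

end Hereditary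

/-! ### Special preenvelopes -/

section Preenvelope

variable (R : Type u) [Ring R] (n : ℕ)

/-- The submodules of `R ^ k` with finitely `n`-presented quotient. -/
abbrev RelationIndex : Type u :=
  Σ k : ℕ, { K : Submodule R (Fin k → R) // IsFinitelyNPresented R n ((Fin k → R) ⧸ K) }

/-- The inclusions into `R ^ k` of the submodules with finitely `n`-presented quotient. -/
def relationInclusions : MorphismProperty (ModuleCat.{u} R) :=
  MorphismProperty.ofHoms fun i : RelationIndex R n => ModuleCat.ofHom i.2.1.subtype

instance : MorphismProperty.IsSmall.{u} (relationInclusions R n) := by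
  dsimp [relationInclusions]
  infer_instance

theorem relationInclusions_le_monomorphisms :
    relationInclusions R n ≤ MorphismProperty.monomorphisms (ModuleCat.{u} R) := by
  rintro _ _ _ ⟨i⟩
  exact (ModuleCat.mono_iff_injective _).2 i.2.1.injective_subtype

-- Take a regular κ exceeding the number of subobjects of each relation module. Attaching cells
-- yields chains of monomorphisms, and Hom out of a relation module commutes with κ-indexed colimits
-- of such chains.
open MorphismProperty IsGrothendieckAbelian in
instance : HasSmallObjectArgument.{u} (relationInclusions R n) := by
  obtain ⟨κ, hκ', hκ⟩ := HasCardinalLT.exists_regular_cardinal_forall.{u}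
    fun i : RelationIndex R n => Subobject (ModuleCat.of R i.2.1)
  have : Fact κ.IsRegular := ⟨hκ'⟩
  have : Nonempty κ.ord.ToType := by simpa using hκ'.ne_zero
  have := WellFoundedLT.toOrderBot κ.ord.ToType
  exact ⟨κ, inferInstance, inferInstance,
    { preservesColimit {A B X Y} i hi f hf := by
        let hf' : (monomorphisms (ModuleCat.{u} R)).TransfiniteCompositionOfShape κ.ord.ToType f :=
          { toTransfiniteCompositionOfShape := hf.toTransfiniteCompositionOfShape
            map_mem j hj := by
              have := (hf.attachCells j hj).pushouts_coproducts
              simp only [ofHoms_homFamily] at this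
              refine (?_ : _ ≤ monomorphisms _) _ this
              rw [pushouts_le_iff, coproducts_le_iff]
              exact relationInclusions_le_monomorphisms R n }
        have (j j' : κ.ord.ToType) (φ : j ⟶ j') : Mono (hf'.F.map φ) := hf'.mem_map φ
        apply preservesColimit_coyoneda_obj_of_mono (Y := hf'.F) (κ := κ)
        obtain ⟨S⟩ := hi
        exact hκ S }⟩

variable {R n}

/-- Reduces FP_n-injectivity to a set of test inclusions, as the small object argument requires. -/
theorem fpInj_succ_iff_extension (X : ModuleCat.{u} R) :
    FPInj R (n + 1) X ↔ ∀ (i : RelationIndex R (n + 1)) (f : i.2.1 →ₗ[R] X),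
      ∃ g : (Fin i.1 → R) →ₗ[R] X, g ∘ₗ i.2.1.subtype = f := by
  constructor
  · rintro h ⟨k, K, hK⟩ f
    have h1 := (ext_one_iff K.mkQ_surjective X).1 (h (ModuleCat.of R _) hK)
    obtain ⟨g, hg⟩ := h1 (f ∘ₗ (LinearEquiv.ofEq _ _ K.ker_mkQ).toLinearMap)
    exact ⟨g, LinearMap.ext fun x => LinearMap.congr_fun hg ⟨x, K.ker_mkQ.symm ▸ x.2⟩⟩
  · intro h F hF
    obtain ⟨k, π, hπ, -⟩ := hF.exists_presentation
    exact (ext_one_iff hπ X).2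
      (h ⟨k, LinearMap.ker π, hF.of_equiv (π.quotKerEquivOfSurjective hπ).symm⟩)

theorem fpInj_of_rlp {X Z : ModuleCat.{u} R} (p : X ⟶ Z) (hZ : Limits.IsZero Z)
    (hp : (relationInclusions R (n + 1)).rlp p) : FPInj R (n + 1) X := by
  refine (fpInj_succ_iff_extension X).2 fun i f => ?_
  have := hp _ (MorphismProperty.ofHoms.mk i)
  have sq : CommSq (ModuleCat.ofHom f) (ModuleCat.ofHom i.2.1.subtype) p 0 :=
    ⟨hZ.eq_of_tgt _ _⟩
  exact ⟨sq.lift.hom, congrArg ModuleCat.Hom.hom sq.fac_left⟩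

/-- An epimorphism with `FP_n`-injective kernel has the right lifting property with respect to
the relation inclusions. -/
theorem rlp_of_fpInj {S : ShortComplex (ModuleCat.{u} R)} (hS : S.ShortExact)
    (h : FPInj R (n + 1) S.X₁) : (relationInclusions R (n + 1)).rlp S.g := by
  rintro _ _ _ ⟨i⟩
  refine ⟨fun {a b} sq => ?_⟩
  -- Lift the bottom map using freeness of R^k. The failure of the upper triangle takes values in
  -- the kernel of `S.g`, which is FP_n-injective, so it extends to R^k and corrects the lift.
  obtain ⟨c, hc⟩ := Module.projective_lifting_property S.g.hom b.hom hS.moduleCat_surjective_g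
  have hex := (ShortComplex.ShortExact.moduleCat_exact_iff_function_exact _).1 hS.exact
  have hsq : ∀ x : i.2.1, S.g.hom (a.hom x) = b.hom (x : Fin i.1 → R) := fun x =>
    congrArg (fun f : ModuleCat.of R i.2.1 ⟶ S.X₃ => f.hom x) sq.w
  have hc' : ∀ x, S.g.hom (c x) = b.hom x := fun x => LinearMap.congr_fun hc x
  let δ : i.2.1 →ₗ[R] LinearMap.range S.f.hom :=
    (a.hom - c ∘ₗ i.2.1.subtype).codRestrict (LinearMap.range S.f.hom) fun x =>
      (hex _).1 (by simp [hsq, hc'])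
  let e := LinearEquiv.ofInjective S.f.hom hS.moduleCat_injective_f
  obtain ⟨g, hg⟩ := (fpInj_succ_iff_extension S.X₁).1 h i (e.symm.toLinearMap ∘ₗ δ)
  have hg' : ∀ x : i.2.1, S.f.hom (g x) = a.hom x - c x := fun x => by
    have h1 : g x = e.symm (δ x) := LinearMap.congr_fun hg x
    have h2 : e (g x) = δ x := by rw [h1, LinearEquiv.apply_symm_apply]
    exact congrArg Subtype.val h2
  refine ⟨⟨⟨ModuleCat.ofHom (c + S.f.hom ∘ₗ g), ?_, ?_⟩⟩⟩
  · refine ModuleCat.hom_ext (LinearMap.ext fun x => ?_)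
    change c x + S.f.hom (g x) = a.hom x
    rw [hg', add_sub_cancel]
  · refine ModuleCat.hom_ext (LinearMap.ext fun x => ?_)
    change S.g.hom (c x + S.f.hom (g x)) = b.hom x
    rw [map_add, hc', hex.apply_apply_eq_zero, add_zero]

-- The map X → 0 is an epimorphism with kernel X, so it lies in the right lifting class.
open scoped ZeroObject in
theorem exists_extension_of_llp {A T X : ModuleCat.{u} R} (i : A ⟶ T)
    (hi : (relationInclusions R (n + 1)).rlp.llp i) (hX : FPInj R (n + 1) X) (f : A ⟶ X) :
    ∃ g : T ⟶ X, i ≫ g = f := by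
  let S : ShortComplex (ModuleCat.{u} R) := ShortComplex.mk (𝟙 X) (0 : X ⟶ 0) (by simp)
  have hS : S.ShortExact := (ShortComplex.Splitting.mk (𝟙 X) 0 (by simp [S])
    ((Limits.isZero_zero _).eq_of_tgt _ _) (by simp [S])).shortExact
  have := hi _ (rlp_of_fpInj hS hX)
  have sq : CommSq f i S.g 0 := ⟨by simp [S]⟩
  exact ⟨sq.lift, sq.fac_left⟩

open scoped ZeroObject in
variable (n) in
/-- Every module `A` embeds into an `FP_n`-injective module `T` such that the cokernel is left
orthogonal to all `FP_n`-injective modules. -/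
theorem exists_special_preenvelope (A : ModuleCat.{u} R) :
    ∃ (T : ModuleCat.{u} R) (i : A →ₗ[R] T), Function.Injective i ∧ FPInj R (n + 1) T ∧
      ∀ X : ModuleCat.{u} R, FPInj R (n + 1) X →
        Subsingleton (Abelian.Ext (ModuleCat.of R (T ⧸ LinearMap.range i)) X 1) := by
  let fac := (MorphismProperty.functorialFactorizationData (relationInclusions R (n + 1)).rlp.llp
    (relationInclusions R (n + 1)).rlp).factorizationData (0 : A ⟶ 0)
  refine ⟨fac.Z, fac.i.hom, ?_, fpInj_of_rlp fac.p (Limits.isZero_zero _) fac.hp, fun X hX => ?_⟩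
  · obtain ⟨p⟩ := EnoughInjectives.presentation A
    have := p.injective
    -- An embedding of A into an injective module, which is FP_n-injective, factors through A → T;
    -- hence A → T is a monomorphism.
    obtain ⟨g, hg⟩ := exists_extension_of_llp fac.i fac.hi (X := p.J)
      (fun F _ => subsingleton_of_forall_eq 0 fun x => Abelian.Ext.eq_zero_of_injective x) p.f
    have hm : Mono (fac.i ≫ g) := by rw [hg]; infer_instance
    have := mono_of_mono fac.i g
    exact (ModuleCat.mono_iff_injective _).1 this
  · obtain ⟨p⟩ := EnoughInjectives.presentation X
    have := p.injective
    have hS : (ShortComplex.mk _ _ (Limits.cokernel.condition p.f)).ShortExact :=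
      { exact := ShortComplex.exact_cokernel p.f }
    have : Injective (ShortComplex.mk _ _ (Limits.cokernel.condition p.f)).X₂ := p.injective
    refine (subsingleton_ext_one_iff_lift hS _).2 fun f => ?_
    have := fac.hi _ (rlp_of_fpInj hS hX)
    -- For X inside an injective J, a map T/A → J/X is a square with zero top row against J → J/X,
    -- whose kernel X is FP_n-injective. Its diagonal kills A and so factors through T/A, which
    -- avoids any filtration of the cokernel.
    have sq : CommSq (0 : A ⟶ p.J) fac.i (Limits.cokernel.π p.f)
        (ModuleCat.ofHom (LinearMap.range fac.i.hom).mkQ ≫ f) := ⟨by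
      rw [Limits.zero_comp]
      refine ModuleCat.hom_ext (LinearMap.ext fun x => Eq.symm ?_)
      have h0 : (LinearMap.range fac.i.hom).mkQ (fac.i.hom x) = 0 :=
        (Submodule.Quotient.mk_eq_zero _).2 ⟨x, rfl⟩
      change f.hom ((LinearMap.range fac.i.hom).mkQ (fac.i.hom x)) = 0
      rw [h0, map_zero]⟩
    have hl : LinearMap.range fac.i.hom ≤ LinearMap.ker sq.lift.hom := by
      rintro _ ⟨x, rfl⟩
      exact congrArg (fun h : A ⟶ p.J => h.hom x) sq.fac_left
    refine ⟨ModuleCat.ofHom ((LinearMap.range fac.i.hom).liftQ sq.lift.hom hl),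
      ModuleCat.hom_ext (Submodule.linearMap_qext _ (LinearMap.ext fun x => ?_))⟩
    exact congrArg (fun h : fac.Z ⟶ _ => h.hom x) sq.fac_right

end Preenvelope

/-! ### Closure of Ext-orthogonality under extensions and retracts -/

section ExtExtras

variable {R : Type u} [Ring R]

theorem subsingleton_ext_extension_left {S : ShortComplex (ModuleCat.{u} R)}
    (hS : S.ShortExact) {X : ModuleCat.{u} R} {n : ℕ} (h₁ : Subsingleton (Abelian.Ext S.X₁ X n))
    (h₃ : Subsingleton (Abelian.Ext S.X₃ X n)) : Subsingleton (Abelian.Ext S.X₂ X n) := by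
  refine subsingleton_of_forall_eq 0 fun x => ?_
  obtain ⟨y, rfl⟩ := Abelian.Ext.contravariant_sequence_exact₂ hS X x (Subsingleton.elim _ _)
  rw [Subsingleton.elim y 0, Abelian.Ext.comp_zero]

theorem subsingleton_ext_extension_right {S : ShortComplex (ModuleCat.{u} R)}
    (hS : S.ShortExact) {X : ModuleCat.{u} R} {n : ℕ} (h₁ : Subsingleton (Abelian.Ext X S.X₁ n))
    (h₃ : Subsingleton (Abelian.Ext X S.X₃ n)) : Subsingleton (Abelian.Ext X S.X₂ n) := by
  refine subsingleton_of_forall_eq 0 fun x => ?_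
  obtain ⟨y, rfl⟩ := Abelian.Ext.covariant_sequence_exact₂ X hS x (Subsingleton.elim _ _)
  rw [Subsingleton.elim y 0, Abelian.Ext.zero_comp]

theorem subsingleton_ext_of_retract {T T' X : ModuleCat.{u} R} (r : Retract T' T) {n : ℕ}
    (h : Subsingleton (Abelian.Ext T X n)) : Subsingleton (Abelian.Ext T' X n) := by
  refine subsingleton_of_forall_eq 0 fun x => ?_
  have h1 : x = (Abelian.Ext.mk₀ r.i).comp ((Abelian.Ext.mk₀ r.r).comp x (zero_add n))
      (zero_add n) := by simp
  rw [h1, Subsingleton.elim ((Abelian.Ext.mk₀ r.r).comp x (zero_add n)) 0, Abelian.Ext.comp_zero]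

theorem shortExact_ker {P F : Type u} [AddCommGroup P] [Module R P] [AddCommGroup F]
    [Module R F] {π : P →ₗ[R] F} (hπ : Function.Surjective π) :
    (seqOfExact _ _ (exact_ker_subtype π)).ShortExact :=
  shortExact_seqOfExact (LinearMap.ker π).injective_subtype (exact_ker_subtype π) hπ

theorem shortExact_inl_snd (A B : Type u) [AddCommGroup A] [Module R A] [AddCommGroup B]
    [Module R B] : (seqOfExact _ _ (Function.Exact.inl_snd (R := R) (M := A) (N := B))).ShortExact :=
  shortExact_seqOfExact LinearMap.inl_injective Function.Exact.inl_snd LinearMap.snd_surjective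

theorem projective_ker_iff {P : Type u} {F : ModuleCat.{u} R} [AddCommGroup P] [Module R P]
    [Module.Projective R P] {π : P →ₗ[R] F} (hπ : Function.Surjective π) :
    HasProjectiveDimensionLE F 1 ↔ Module.Projective R (LinearMap.ker π) := by
  have h : Projective (ModuleCat.of R P) := (IsProjective.iff_projective P).1 inferInstance
  exact ((shortExact_ker hπ).hasProjectiveDimensionLT_X₃_iff 0 h).trans
    (projective_iff_hasProjectiveDimensionLT_one.symm.trans
      (IsProjective.iff_projective _).symm)

end ExtExtras

/-! ### n-heredity and tilting classes -/

section Tilting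

variable {R : Type u} [Ring R] {m : ℕ}

theorem isNHereditary_iff : IsNHereditary R (m + 1) ↔
    ∀ F : ModuleCat.{u} R, IsFinitelyNPresented R (m + 1) F → HasProjectiveDimensionLE F 1 := by
  constructor
  · intro h F hF
    obtain ⟨k, π, hπ, hK⟩ := hF.exists_presentation
    exact (projective_ker_iff hπ).2 (h.projective_ker π hK)
  · intro h
    refine isNHereditary_of_projective_ker fun k F _ _ π hπ hK => ?_
    exact (projective_ker_iff (F := ModuleCat.of R F) hπ).1
      (h (ModuleCat.of R F) (IsFinitelyNPresented.of_presentation hπ hK))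

theorem fpInj_of_injective {n : ℕ} (X : ModuleCat.{u} R) [Injective X] : FPInj R n X := fun _ _ =>
  subsingleton_of_forall_eq 0 fun x => Abelian.Ext.eq_zero_of_injective x

theorem IsNHereditary.fpInj_quotient (h : IsNHereditary R (m + 1))
    {S : ShortComplex (ModuleCat.{u} R)} (hS : S.ShortExact) (hX : FPInj R (m + 1) S.X₂) :
    FPInj R (m + 1) S.X₃ := fun F hF =>
  subsingleton_ext_one_quotient (isNHereditary_iff.1 h F hF) hS (hX F hF)

/-- The relation module is finitely generated because the presentation level is positive. A map from
it to the direct sum therefore meets finitely many coordinates, and can be extended one coordinate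
at a time. -/
theorem fpInj_finsupp {X : ModuleCat.{u} R} (hX : FPInj R (m + 1) X) (I : Type u) :
    FPInj R (m + 1) (ModuleCat.of R (I →₀ X)) := by
  classical
  intro F hF
  obtain ⟨k, π, hπ, hK⟩ := hF.exists_presentation
  have := hK.finite
  obtain ⟨p, l, hl⟩ := Module.Finite.exists_fin (R := R) (M := LinearMap.ker π)
  refine (ext_one_iff hπ _).2 fun f => ?_
  have hext := (ext_one_iff hπ X).1 (hX F hF)
  choose g hg using fun a : I => hext (Finsupp.lapply a ∘ₗ f)
  let s : Finset I := Finset.univ.biUnion fun i : Fin p => (f (l i)).support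
  refine ⟨∑ a ∈ s, Finsupp.lsingle a ∘ₗ g a, LinearMap.ext_on_range hl fun i => ?_⟩
  have h1 : ∀ a, g a (l i : Fin k → R) = f (l i) a := fun a => LinearMap.congr_fun (hg a) (l i)
  have h2 : (f (l i)).support ⊆ s :=
    Finset.subset_biUnion_of_mem (fun i : Fin p => (f (l i)).support) (Finset.mem_univ i)
  calc (∑ a ∈ s, Finsupp.lsingle a ∘ₗ g a) (l i : Fin k → R)
      = ∑ a ∈ s, Finsupp.single a (f (l i) a) := by
        simp [LinearMap.sum_apply, h1]
    _ = f (l i) := by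
        conv_rhs => rw [← Finsupp.sum_single (f (l i))]
        exact (Finsupp.sum_of_support_subset _ h2 _ fun _ _ => Finsupp.single_zero _).symm

theorem isSummandOfSum_left (A B : Type u) [AddCommGroup A] [Module R A] [AddCommGroup B]
    [Module R B] : IsSummandOfSum (ModuleCat.of R (A × B)) (ModuleCat.of R A) :=
  ⟨PUnit, ModuleCat.of R B, ⟨Finsupp.uniqueLinearEquiv R (A × B) PUnit.unit⟩⟩

theorem isSummandOfSum_right (A B : Type u) [AddCommGroup A] [Module R A] [AddCommGroup B]
    [Module R B] : IsSummandOfSum (ModuleCat.of R (A × B)) (ModuleCat.of R B) :=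
  ⟨PUnit, ModuleCat.of R A,
    ⟨(Finsupp.uniqueLinearEquiv R (A × B) PUnit.unit).trans (LinearEquiv.prodComm R A B)⟩⟩

theorem IsNHereditary.isOneTiltingClass (h : IsNHereditary R (m + 1)) :
    IsOneTiltingClass (FPInj R (m + 1)) := by
  obtain ⟨T₀, i, hi, hT₀, hT₁⟩ := exists_special_preenvelope (R := R) m (ModuleCat.of R R)
  let T₁ : ModuleCat.{u} R := ModuleCat.of R (T₀ ⧸ LinearMap.range i)
  let T : ModuleCat.{u} R := ModuleCat.of R (T₀ × T₁)
  have hex : Function.Exact i (LinearMap.range i).mkQ := LinearMap.exact_map_mkQ_range i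
  have hseq := shortExact_seqOfExact hi hex (Submodule.mkQ_surjective _)
  have hsplit := shortExact_inl_snd (R := R) T₀ T₁
  have hR : Projective (ModuleCat.of R R) := (IsProjective.iff_projective R).1 inferInstance
  have hT : ∀ X, FPInj R (m + 1) X → Subsingleton (Abelian.Ext T X 1) := by
    intro X hX
    refine subsingleton_ext_extension_left hsplit ?_ (hT₁ X hX)
    refine subsingleton_ext_extension_left hseq ?_ (hT₁ X hX)
    exact subsingleton_of_forall_eq 0 fun x => Abelian.Ext.eq_zero_of_projective x
  have hT₁' : FPInj R (m + 1) T₁ := h.fpInj_quotient hseq hT₀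
  have hT' : FPInj R (m + 1) T := fun F hF =>
    subsingleton_ext_extension_right hsplit (hT₀ F hF) (hT₁' F hF)
  -- T is left orthogonal to FP_n-injectives, and these include all quotients of injectives.
  have hpd : HasProjectiveDimensionLE T 1 :=
    hasProjectiveDimensionLE_one_of_quotient_closed T fun S hS _ =>
      hT _ (h.fpInj_quotient hS (fpInj_of_injective _))
  refine ⟨T, ⟨hpd, fun I j hj => ?_, ⟨T₀, T₁, i, (LinearMap.range i).mkQ,
    isSummandOfSum_left _ _, isSummandOfSum_right _ _, hi, hex, Submodule.mkQ_surjective _⟩⟩,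
    fun M => ⟨hT M, fun hM => ?_⟩⟩
  · obtain rfl | hj := hj.eq_or_lt
    · exact hT _ (fpInj_finsupp hT' I)
    · exact HasProjectiveDimensionLT.subsingleton T 2 j hj _
  · have hM₁ : Subsingleton (Abelian.Ext T₁ M 1) :=
      subsingleton_ext_of_retract ⟨ModuleCat.ofHom (LinearMap.inr R T₀ T₁),
        ModuleCat.ofHom (LinearMap.snd R T₀ T₁), rfl⟩ hM
    -- Since Ext¹(T₁, M) = 0, each map R → M extends to T₀, so the images of T₀ generate M.
    have hgen : ∀ x : M, ∃ g : T₀ →ₗ[R] M, g (i (1 : R)) = x := by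
      intro x
      obtain ⟨g, hg⟩ := exists_extension_of_subsingleton_ext hseq hM₁
        (ModuleCat.ofHom (LinearMap.toSpanSingleton R M x))
      refine ⟨g.hom, ?_⟩
      have := congrArg (fun f : ModuleCat.of R R ⟶ M => f.hom (1 : R)) hg
      simpa using this
    choose g hg using hgen
    let q : (M →₀ T₀) →ₗ[R] M := Finsupp.lsum ℕ g
    have hq : Function.Surjective q := fun x =>
      ⟨Finsupp.single x (i (1 : R)), by simp [q, hg]⟩
    exact h.fpInj_quotient (shortExact_ker hq) (fpInj_finsupp hT₀ M)

theorem isNHereditary_of_isOneTiltingClass (h : IsOneTiltingClass (FPInj R (m + 1))) :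
    IsNHereditary R (m + 1) := by
  obtain ⟨T, hT, hclass⟩ := h
  refine isNHereditary_iff.2 fun F hF =>
    hasProjectiveDimensionLE_one_of_quotient_closed F fun S hS _ => ?_
  exact (hclass _).2 (subsingleton_ext_one_quotient hT.projectiveDimension_le_one hS
    ((hclass _).1 (fpInj_of_injective _))) F hF

end Tilting

/-! ### Duals of direct sums and products -/

namespace CharDual

variable {R S : Type*} [Ring R] [Ring S] [AntiHom S R]

/-- The dual of a direct sum of copies of `X` is a product of copies of the dual. -/
def finsuppEquiv (I X : Type*) [AddCommGroup X] [Module R X] :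
    CharDual R S (I →₀ X) ≃ₗ[S] (I → CharDual R S X) where
  toFun χ a := map S (Finsupp.lsingle a) χ
  map_add' _ _ := rfl
  map_smul' s χ := by
    ext1 a
    exact map_smul (map S (Finsupp.lsingle a)) s χ
  invFun φ := Finsupp.liftAddHom φ
  left_inv χ := (Finsupp.liftAddHom (M := X) (N := AddCircle (1 : ℚ))).apply_symm_apply χ
  right_inv φ := (Finsupp.liftAddHom (M := X) (N := AddCircle (1 : ℚ))).symm_apply_apply φ

/-- The dual of a product of two modules. -/
def prodEquiv (X Y : Type*) [AddCommGroup X] [Module R X] [AddCommGroup Y] [Module R Y] :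
    CharDual R S (X × Y) ≃ₗ[S] CharDual R S X × CharDual R S Y where
  toFun χ := (map S (LinearMap.inl R X Y) χ, map S (LinearMap.inr R X Y) χ)
  map_add' _ _ := rfl
  map_smul' s χ := by
    rw [map_smul (map S (LinearMap.inl R X Y)), map_smul (map S (LinearMap.inr R X Y))]
    rfl
  invFun φ := map S (LinearMap.fst R X Y) φ.1 + map S (LinearMap.snd R X Y) φ.2
  left_inv χ := ext fun x => by
    simp [← map_add χ]
  right_inv φ := by
    refine Prod.ext (ext fun x => ?_) (ext fun y => ?_) <;> simp

/-- Isomorphic modules have isomorphic duals. -/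
def congr {X Y : Type*} [AddCommGroup X] [Module R X] [AddCommGroup Y] [Module R Y]
    (e : X ≃ₗ[R] Y) : CharDual R S X ≃ₗ[S] CharDual R S Y :=
  LinearEquiv.ofLinearMap (map S e.symm.toLinearMap) (map S e.toLinearMap)
    (LinearMap.ext fun χ => ext fun y => by simp) (LinearMap.ext fun χ => ext fun y => by simp)

end CharDual

/-! ### Transfer of homological conditions to the dual -/

section

variable {R S : Type u} [Ring R] [Ring S] [AntiHom S R]

theorem IsSummandOfSum.charDual {T X : ModuleCat.{u} R} (h : IsSummandOfSum T X) :
    IsSummandOfProd (ModuleCat.of S (CharDual R S T)) (ModuleCat.of S (CharDual R S X)) := by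
  obtain ⟨I, Y, ⟨e⟩⟩ := h
  exact ⟨I, ModuleCat.of S (CharDual R S Y), ⟨(CharDual.finsuppEquiv I T).symm.trans
    ((CharDual.congr e).trans (CharDual.prodEquiv X Y))⟩⟩

theorem shortExact_charDual {A B C : Type u} [AddCommGroup A] [Module R A] [AddCommGroup B]
    [Module R B] [AddCommGroup C] [Module R C] {f : A →ₗ[R] B} {g : B →ₗ[R] C}
    (hf : Function.Injective f) (h : Function.Exact f g) (hg : Function.Surjective g) :
    (seqOfExact (CharDual.map S g) (CharDual.map S f) (CharDual.map_exact h)).ShortExact :=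
  shortExact_seqOfExact (CharDual.map_injective hg) _ (CharDual.map_surjective hf)

variable [AntiHom R S] [AntiPair R S]

/-- A character c with c(y) ≠ 0 defines R → Y⁺ by 1 ↦ c, and exchanging the arguments gives a map Y
→ R⁺ that does not kill y. -/
theorem isCoseparator_charDual : IsCoseparator (ModuleCat.of S (CharDual R S R)) := by
  refine (isCoseparator_def _).2 fun X Y f g hfg => ModuleCat.hom_ext (LinearMap.ext fun x => ?_)
  by_contra hne
  obtain ⟨c, hc⟩ := CharacterModule.exists_character_apply_ne_zero_of_ne_zero
    (sub_ne_zero.2 hne)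
  let c' : CharDual S R Y := c
  have h1 := hfg (ModuleCat.ofHom (CharDual.flip (LinearMap.toSpanSingleton R _ c')))
  have h2 := DFunLike.congr_fun (congrArg (fun h : X ⟶ _ => h.hom x) h1) (1 : R)
  have h3 : (LinearMap.toSpanSingleton R _ c' (1 : R)) (f.hom x) =
    (LinearMap.toSpanSingleton R _ c' (1 : R)) (g.hom x) := h2
  rw [LinearMap.toSpanSingleton_apply, one_smul] at h3
  have h4 : c' (f.hom x - g.hom x) = 0 := by rw [map_sub, h3, sub_self]
  exact hc h4

variable [AntiPair S R]

theorem injective_of_charDual (P : Type u) [AddCommGroup P] [Module R P] [Module.Projective R P] :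
    Injective (ModuleCat.of S (CharDual R S P)) :=
  (Module.injective_iff_injective_object S _).1 (injective_charDual P)

/-- The vanishing of `Ext¹(T, M⁺)` is symmetric in `T` and `M`. -/
theorem subsingleton_ext_charDual_comm (T : ModuleCat.{u} R) (M : ModuleCat.{u} S)
    (h : Subsingleton (Abelian.Ext T (ModuleCat.of R (CharDual S R M)) 1)) :
    Subsingleton (Abelian.Ext M (ModuleCat.of S (CharDual R S T)) 1) := by
  have hT := Finsupp.linearCombination_id_surjective R T
  have hM := Finsupp.linearCombination_id_surjective S M
  exact (ext_one_iff hM _).2 (balanced_extension hT hM ((ext_one_iff hT _).1 h))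

/-- Dualizing a projective resolution of length 1 gives an injective coresolution of length 1. -/
theorem hasInjectiveDimensionLE_one_charDual {T : ModuleCat.{u} R}
    (hT : HasProjectiveDimensionLE T 1) :
    HasInjectiveDimensionLE (ModuleCat.of S (CharDual R S T)) 1 := by
  have hπ := Finsupp.linearCombination_id_surjective R T
  have := (projective_ker_iff hπ).1 hT
  have h1 := injective_of_charDual (R := R) (S := S) (T →₀ R)
  have h2 := injective_of_charDual (R := R) (S := S)
    (LinearMap.ker (Finsupp.linearCombination R (id : T → T)))
  exact ((shortExact_charDual (S := S) (LinearMap.ker _).injective_subtype (exact_ker_subtype _)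
    hπ).hasInjectiveDimensionLT_X₃_iff 0 h1).1 (injective_iff_hasInjectiveDimensionLT_one.1 h2)

end

/-! ### n-heredity and cotilting classes -/

section Cotilting

variable {R : Type u} [Ring R] {m : ℕ}

theorem fpFlat_iff_fpInj {n : ℕ} (M : ModuleCat.{u} Rᵐᵒᵖ) :
    FPFlat R n M ↔ FPInj R n (ModuleCat.of R (CharDual Rᵐᵒᵖ R M)) :=
  forall_congr' fun F => imp_congr_right fun _ => subsingleton_tor_one_iff M F

/-- Amounts to FP_n-injectivity of N⁺⁺. Heredity makes the syzygy of F finitely generated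
projective, so extension of its maps passes from N to N⁺⁺. -/
theorem IsNHereditary.fpFlat_charDual (h : IsNHereditary R (m + 1)) {N : ModuleCat.{u} R}
    (hN : FPInj R (m + 1) N) : FPFlat R (m + 1) (ModuleCat.of Rᵐᵒᵖ (CharDual R Rᵐᵒᵖ N)) := by
  refine (fpFlat_iff_fpInj _).2 fun F hF => ?_
  obtain ⟨k, π, hπ, hK⟩ := hF.exists_presentation
  have := hK.finite
  have := h.projective_ker π hK
  exact (ext_one_iff hπ _).2
    (double_dual_extension (S := Rᵐᵒᵖ) _ ((ext_one_iff hπ N).1 (hN F hF)))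

theorem IsNHereditary.isOneCotiltingClass (h : IsNHereditary R (m + 1)) :
    IsOneCotiltingClass (FPFlat R (m + 1)) := by
  obtain ⟨T, hT, hclass⟩ := h.isOneTiltingClass
  let C : ModuleCat.{u} Rᵐᵒᵖ := ModuleCat.of Rᵐᵒᵖ (CharDual R Rᵐᵒᵖ T)
  have hC : ∀ M, FPFlat R (m + 1) M ↔ Subsingleton (Abelian.Ext M C 1) := fun M =>
    ((fpFlat_iff_fpInj M).trans (hclass _)).trans
      ⟨subsingleton_ext_charDual_comm T M, subsingleton_ext_charDual_comm M T⟩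
  have hid : HasInjectiveDimensionLE C 1 :=
    hasInjectiveDimensionLE_one_charDual hT.projectiveDimension_le_one
  refine ⟨C, ⟨hid, fun I j hj => ?_, ModuleCat.of Rᵐᵒᵖ (CharDual R Rᵐᵒᵖ R),
    injective_of_charDual R, isCoseparator_charDual, ?_⟩, hC⟩
  · obtain rfl | hj := hj.eq_or_lt
    · have h1 := h.fpFlat_charDual ((hclass (ModuleCat.of R (I →₀ T))).2
        (hT.ext_directSum_eq_zero I 1 le_rfl))
      let e : ModuleCat.of Rᵐᵒᵖ (CharDual R Rᵐᵒᵖ (I →₀ T)) ≅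
          ModuleCat.of Rᵐᵒᵖ (I → CharDual R Rᵐᵒᵖ T) :=
        (CharDual.finsuppEquiv (S := Rᵐᵒᵖ) I T).toModuleIso
      exact subsingleton_ext_of_subsingleton_of_iso e (Iso.refl C) 1 ((hC _).1 h1)
    · exact HasInjectiveDimensionLT.subsingleton C 2 j hj _
  · obtain ⟨T₀, T₁, f, g, h₀, h₁, hf, hfg, hg⟩ := hT.exists_coresolution
    exact ⟨ModuleCat.of Rᵐᵒᵖ (CharDual R Rᵐᵒᵖ T₁), ModuleCat.of Rᵐᵒᵖ (CharDual R Rᵐᵒᵖ T₀),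
      CharDual.map Rᵐᵒᵖ g, CharDual.map Rᵐᵒᵖ f, h₀.charDual, h₁.charDual,
      CharDual.map_injective hg, CharDual.map_exact hfg, CharDual.map_surjective hf⟩

theorem isNHereditary_of_isOneCotiltingClass
    (h : IsOneCotiltingClass (FPFlat R (m + 2))) : IsNHereditary R (m + 2) := by
  obtain ⟨C, hC, hclass⟩ := h
  refine isNHereditary_of_projective_ker fun k F _ _ π hπ hK => ?_
  have hF : IsFinitelyNPresented R (m + 2) F := IsFinitelyNPresented.of_presentation hπ hK
  have key : ∀ M : ModuleCat.{u} Rᵐᵒᵖ, Subsingleton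
      (Abelian.Ext (ModuleCat.of R (LinearMap.ker π)) (ModuleCat.of R (CharDual Rᵐᵒᵖ R M)) 1) := by
    intro M
    have hM := Finsupp.linearCombination_id_surjective Rᵐᵒᵖ M
    have hG : Projective (ModuleCat.of Rᵐᵒᵖ (M →₀ Rᵐᵒᵖ)) :=
      (IsProjective.iff_projective _).1 inferInstance
    -- The kernel L of a free cover of M is FP_n-flat, so Ext¹(F, L⁺) = 0. The sequence M⁺ → (free)⁺
    -- → L⁺ with injective middle term then gives Ext²(F, M⁺) = 0.
    have hL := (fpFlat_iff_fpInj _).1 ((hclass _).2 (subsingleton_ext_one_sub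
      hC.injectiveDimension_le_one (shortExact_ker hM)
      (subsingleton_of_forall_eq 0 fun x => Abelian.Ext.eq_zero_of_projective x)))
      (ModuleCat.of R F) hF
    have hinj := injective_of_charDual (R := Rᵐᵒᵖ) (S := R) (M →₀ Rᵐᵒᵖ)
    have h2 := (subsingleton_ext_two_iff (shortExact_charDual (S := R)
      (LinearMap.ker _).injective_subtype (exact_ker_subtype _) hM) (ModuleCat.of R F)).2 hL
    have hP : Projective (ModuleCat.of R (Fin k → R)) :=
      (IsProjective.iff_projective _).1 inferInstance
    exact subsingleton_ext_one_of_ext_two (shortExact_ker hπ) _ h2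
  -- Here n > 1 enters: the syzygy of F has a further presentation, with finitely generated kernel.
  obtain ⟨p, ρ, hρ, hL⟩ := hK.exists_presentation
  have := hL.finite
  exact projective_of_double_dual_extension (S := Rᵐᵒᵖ) hρ
    ((ext_one_iff hρ _).1 (key (ModuleCat.of Rᵐᵒᵖ (CharDual R Rᵐᵒᵖ (LinearMap.ker ρ)))))

end Cotilting

end

end FPn

theorem mainTheorem3 (R : Type u) [Ring R] (n : ℕ) (hn : 1 < n) :
    List.TFAE [
      FPn.IsNHereditary R n,
      FPn.IsOneTiltingClass (FPn.FPInj R n),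
      FPn.IsOneCotiltingClass (FPn.FPFlat R n)] := by
  -- Only the implication from 3 to 1 needs n ≥ 2; the others are proved for n ≥ 1.
  obtain ⟨m, rfl⟩ : ∃ m, n = m + 2 := ⟨n - 2, by omega⟩
  tfae_have 1 → 2 := FPn.IsNHereditary.isOneTiltingClass
  tfae_have 2 → 1 := FPn.isNHereditary_of_isOneTiltingClass
  tfae_have 1 → 3 := FPn.IsNHereditary.isOneCotiltingClass
  tfae_have 3 → 1 := FPn.isNHereditary_of_isOneCotiltingClass
  tfae_finish
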